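/- **Theorem.** Let $\Gamma\in\mathbb R^{k\times k}$ be symmetric positive definite with all eigenvalues bounded below by $\mu_{\min}$, where $0<\mu_{\min}\le 1$. Let $C\ge 1$, $\beta\ge 1$, $0<p<1$ with $p<1/\beta$, $0<\delta<\tfrac12$, $K>0$, and let $\boldsymbol b=(b_j)_{j\ge1}\in\ell^p(\mathbb N)$ have nonnegative entries. Let $\Theta_s=[-\tfrac12,\tfrac12]^s$ and let $G_s:\Theta_s\times\Xi\to\mathbb R^k$, indexed by $s$, be a sequence of forward models, infinitely differentiable in $\boldsymbol\theta$, such that $$\|\partial^{\boldsymbol\nu}_{\boldsymbol\theta}G_s(\boldsymbol\theta,\boldsymbol\xi)\|\le C\,(|\boldsymbol\nu|!)^\beta\,\boldsymbol b^{\boldsymbol\nu}\qquad\text{for all } s,\ \boldsymbol\theta\in\Theta_s,\ \boldsymbol\xi\in\Xi,\ \boldsymbol\nu\in\mathbb N_0^s .$$ For $\boldsymbol y\in\mathbb R^k$ and $\boldsymbol\xi\in\Xi$ let $$f(\boldsymbol\theta)=C_{k,\Gamma}\,e^{-\frac12\|\boldsymbol y-G_s(\boldsymbol\theta,\boldsymbol\xi)\|_{\Gamma^{-1}}^2},\quad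 C_{k,\Gamma}=\det(2\pi\Gamma)^{-1/2},\quad \|\boldsymbol x\|_{\Gamma^{-1}}=\sqrt{\boldsymbol x^{\rm T}\Gamma^{-1}\boldsymbol x},\quad I_s(f)=\int_{\Theta_s}f(\boldsymbol\theta)\,{\rm d}\boldsymbol\theta .$$ For a generating vector $\boldsymbol z\in\mathbb N^s$ let $\boldsymbol t_i=\{i\boldsymbol z/n\}$, $1\le i\le n$ (componentwise fractional parts), and let $$\overline Q_{n,R}(f)=\frac1{nR}\sum_{r=1}^R\sum_{i=1}^n f\big(\{\boldsymbol t_i+\boldsymbol\Delta_r\}-\tfrac{\mathbf 1}{\mathbf 2}\big)$$ with $\boldsymbol\Delta_1,\dots,\boldsymbol\Delta_R$ independent and uniformly distributed on $[0,1]^s$. Put $$\lambda=\begin{cases}\frac{p}{2-p}&\text{if } p>\frac23,\\[2pt] \frac1{2-2\delta}&\text{if } p\le\frac23,\end{cases}\qquad c_j=\frac{2^\beta C}{\sqrt{\mu_{\min}}}\,b_j,\qquad \gamma_{\mathfrak u}=\Bigg((|\mathfrak u|!)^\beta\prod_{j\in\mathfrak u}\frac{c_j}{\sqrt{2\zeta(2\lambda)/(2\pi^2)^\lambda}}\Bigg)^{\frac{2}{1+\lambda}}\quad(\mathfrak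 u\subseteq\{1,\dots,s\}).$$ The component-by-component (CBC) algorithm with weights $\boldsymbol\gamma$ chooses $z_1,z_2,\dots,z_s$ one after the other, $z_d$ being a minimizer, over the integers in $\{1,\dots,n\}$ coprime to $n$, of the squared shift-averaged worst-case error in the unanchored weighted Sobolev space, $$\sum_{\varnothing\ne\mathfrak u\subseteq\{1,\dots,d\}}\gamma_{\mathfrak u}\,\frac1n\sum_{i=1}^n\prod_{j\in\mathfrak u}B_2\big(\{iz_j/n\}\big),\qquad B_2(x)=x^2-x+\tfrac16 .$$ Then there is a constant $C'>0$, independent of the dimension $s$ and of $n$ (and also of $R$, of $\boldsymbol\xi$ and of $\boldsymbol y\in[-K,K]^k$), such that for all $s$ and all $n=2^m$, $m\ge0$, the CBC algorithm with weights $\boldsymbol\gamma$ yields a generating vector, and every generating vector it can yield satisfies, for all $\boldsymbol\xi\in\Xi$, $\boldsymbol y\in[-K,K]^k$ and $R\ge1$, $$\sqrt{\mathbb E_{\boldsymbol\Delta}\big|I_s(f)-\overline Q_{n,R}(f)\big|^2}\le C'\,n^{\max\{-1/p+1/2,\;-1+\delta\}} .$$ Here $f$ is integrable over $\Theta_s$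 and the error $I_s(f)-\overline Q_{n,R}(f)$ is square integrable in the shifts. -/

import Mathlib

open MeasureTheory
open scoped ContDiff

noncomputable section

namespace LatticeBOED

/-- The parameter domain `Θ_s = [-1/2, 1/2]^s`. -/
def paramBox (s : ℕ) : Set (Fin s → ℝ) :=
  Set.Icc (fun _ => -(1 / 2)) (fun _ => 1 / 2)

/-- The coordinate directions along which the multi-index `ν` differentiates:
coordinate `j` is listed `ν j` times. -/
def multiIndexDirs {s : ℕ} (ν : Fin s → ℕ) : List (Fin s) :=
  (List.finRange s).flatMap fun j => List.replicate (ν j) j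

/-- The mixed partial derivative `∂^ν F (θ)` of a function on `S` (one-sided at the boundary):
the derivative of order `|ν|` within `S`, evaluated at the coordinate directions of `ν`. -/
def partialDerivWithin {s : ℕ} {E : Type*} [NormedAddCommGroup E] [NormedSpace ℝ E]
    (F : (Fin s → ℝ) → E) (S : Set (Fin s → ℝ)) (ν : Fin s → ℕ) (θ : Fin s → ℝ) : E :=
  iteratedFDerivWithin ℝ (multiIndexDirs ν).length F S θ
    (fun i => Pi.single ((multiIndexDirs ν).get i) (1 : ℝ))

/-- The Gevrey-type parametric regularity bound with constants `C`, `β`, `b`, for a sequence of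
forward models `G s : Θ_s × Ξ → ℝ^k`; the values of `G s` outside `Θ_s` play no role. -/
def ParametricRegularity {k : ℕ} {Ξ : Type*} (C β : ℝ) (b : ℕ → ℝ)
    (G : (s : ℕ) → (Fin s → ℝ) → Ξ → EuclideanSpace ℝ (Fin k)) : Prop :=
  ∀ (s : ℕ) (ξ : Ξ),
    ContDiffOn ℝ ∞ (fun θ => G s θ ξ) (paramBox s) ∧
    ∀ θ ∈ paramBox s, ∀ ν : Fin s → ℕ,
      ‖partialDerivWithin (fun θ' => G s θ' ξ) (paramBox s) ν θ‖ ≤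
        C * ((∑ j, ν j).factorial : ℝ) ^ β * ∏ j : Fin s, b j ^ ν j

/-- The weighted norm `‖x‖_{Γ⁻¹} = √(xᵀ Γ⁻¹ x)`. -/
def precNorm {k : ℕ} (Γ : Matrix (Fin k) (Fin k) ℝ) (x : EuclideanSpace ℝ (Fin k)) : ℝ :=
  Real.sqrt ((fun i => x i) ⬝ᵥ (Γ⁻¹.mulVec fun i => x i))

/-- The Gaussian normalisation `C_{k,Γ} = det(2πΓ)^{-1/2}`. -/
def gaussConst {k : ℕ} (Γ : Matrix (Fin k) (Fin k) ℝ) : ℝ :=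
  1 / Real.sqrt (((2 * Real.pi) • Γ).det)

/-- The likelihood `C_{k,Γ} exp(-½ ‖y - g‖²_{Γ⁻¹})` of the data `y` for the model output `g`. -/
def likelihood {k : ℕ} (Γ : Matrix (Fin k) (Fin k) ℝ) (y g : EuclideanSpace ℝ (Fin k)) : ℝ :=
  gaussConst Γ * Real.exp (-(1 / 2) * precNorm Γ (y - g) ^ 2)

/-- The lattice point `t_i = {i z / n}` (componentwise fractional part). -/
def latticePoint {s : ℕ} (n : ℕ) (z : Fin s → ℕ) (i : ℕ) : Fin s → ℝ :=
  fun j => Int.fract ((i : ℝ) * (z j : ℝ) / (n : ℝ))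

/-- The randomly shifted lattice rule on `Θ_s` with the shifts `Δ 0, …, Δ (R - 1)`:
`(nR)⁻¹ ∑_r ∑_{i=1}^n f({t_i + Δ_r} - 1/2)`. -/
def shiftedLatticeRule {s : ℕ} (n : ℕ) (z : Fin s → ℕ) (R : ℕ) (f : (Fin s → ℝ) → ℝ)
    (Δ : Fin R → Fin s → ℝ) : ℝ :=
  1 / ((n : ℝ) * (R : ℝ)) *
    ∑ r : Fin R, ∑ i ∈ Finset.Icc 1 n,
      f (fun j => Int.fract (latticePoint n z i j + Δ r j) - 1 / 2)

/-- The law of `R` independent random shifts, each uniformly distributed on `[0,1]^s`. -/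
def shiftLaw (s R : ℕ) : Measure (Fin R → Fin s → ℝ) :=
  Measure.pi fun _ => (volume : Measure (Fin s → ℝ)).restrict (Set.Icc 0 1)

/-- The cubature error `I_s(f) - Q̄_{n,R}(f)` as a function of the shifts. -/
def cubatureError {s : ℕ} (n : ℕ) (z : Fin s → ℕ) (R : ℕ) (f : (Fin s → ℝ) → ℝ)
    (Δ : Fin R → Fin s → ℝ) : ℝ :=
  (∫ θ in paramBox s, f θ) - shiftedLatticeRule n z R f Δ

/-- The root-mean-square error `√(𝔼_Δ |I_s(f) - Q̄_{n,R}(f)|²)`. -/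
def rmsError {s : ℕ} (n : ℕ) (z : Fin s → ℕ) (R : ℕ) (f : (Fin s → ℝ) → ℝ) : ℝ :=
  Real.sqrt (∫ Δ, |cubatureError n z R f Δ| ^ 2 ∂(shiftLaw s R))

/-- The squared shift-averaged worst-case error, in the unanchored Sobolev space with weights
`γ`, of the lattice rule generated by the components of `z` up to index `d`:
`∑_{∅ ≠ u ⊆ {0,…,d}} γ_u · n⁻¹ ∑_{i=1}^n ∏_{j ∈ u} B₂({i z_j / n})`,
with the Bernoulli polynomial `B₂(x) = x² - x + 1/6`. -/
def shiftAvgErrorSq {s : ℕ} (n : ℕ) (γ : Finset (Fin s) → ℝ) (d : Fin s) (z : Fin s → ℕ) : ℝ :=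
  ∑ u ∈ (Finset.Iic d).powerset.erase ∅,
    γ u * (1 / (n : ℝ) * ∑ i ∈ Finset.Icc 1 n, ∏ j ∈ u, bernoulliFun 2 (latticePoint n z i j))

/-- The candidates for one component of a generating vector: the residues modulo `n` that are
coprime to `n`, represented in `{1, …, n}`. -/
def cbcCandidates (n : ℕ) : Finset ℕ :=
  (Finset.Icc 1 n).filter fun w => Nat.Coprime w n

/-- `z` is an output of the component-by-component algorithm with input weights `γ`: one after
the other, each component is chosen among the candidates so as to minimise the shift-averaged
worst-case error of the rule built so far, the previous components being kept. -/
def IsCBCOutput {s : ℕ} (n : ℕ) (γ : Finset (Fin s) → ℝ) (z : Fin s → ℕ) : Prop :=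
  ∀ d : Fin s, z d ∈ cbcCandidates n ∧
    ∀ w ∈ cbcCandidates n,
      shiftAvgErrorSq n γ d z ≤ shiftAvgErrorSq n γ d (Function.update z d w)

/-- `ζ(x) = ∑_{ℓ ≥ 1} ℓ^{-x}`, used for `x > 1` only. -/
def zetaSum (x : ℝ) : ℝ := ∑' l : ℕ, ((l : ℝ) + 1) ^ (-x)

/-- `2 ζ(2λ) / (2π²)^λ`. -/
def rho (lam : ℝ) : ℝ := 2 * zetaSum (2 * lam) / (2 * Real.pi ^ 2) ^ lam

/-- The exponent `λ`, as a function of the summability exponent `p < 1/β` and of `δ`. -/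
def weightExponent (p δ : ℝ) : ℝ :=
  if 2 / 3 < p then p / (2 - p) else 1 / (2 - 2 * δ)

/-- `c_j = 2^β C b_j / √μ_min`. -/
def podFactor (C β μmin : ℝ) (b : ℕ → ℝ) (j : ℕ) : ℝ :=
  (2 : ℝ) ^ β * C / Real.sqrt μmin * b j

/-- The product-and-order dependent weights
`γ_u = ((|u|!)^β ∏_{j ∈ u} c_j / √(2ζ(2λ)/(2π²)^λ))^{2/(1+λ)}`. -/
def podWeight (C β μmin lam : ℝ) (b : ℕ → ℝ) {s : ℕ} (u : Finset (Fin s)) : ℝ :=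
  ((u.card.factorial : ℝ) ^ β *
    ∏ j ∈ u, podFactor C β μmin b j / Real.sqrt (rho lam)) ^ (2 / (1 + lam))

end LatticeBOED

end

/-! The error is controlled by comparing the Fourier coefficients of the likelihood with those of
the Bernoulli kernel in the CBC criterion.

Regularity. The misfit is quadratic in `y - G`, so by the product rule its first order mixed
derivatives inherit a Gevrey bound. The recursion for derivatives of an exponential passes it on to
the likelihood: `∂^u f` is at most `A (|u|!)^β ∏_{j ∈ u} κ b_j`, with `A` and `κ` independent of
`s`, the design and the data (`exists_likelihood_gevreyBound`).

Fourier decay. Viewed on the torus, the integrand jumps where the box is glued. Shifting by half a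
period in each active coordinate, however, turns `2^|u|` times the coefficient at a frequency `h`
with support `u` into the coefficient of a mixed difference. Mixed derivatives bound that
difference, and its mean stays small in spite of the jumps (`norm_mFourierCoeff_le`). The squared
coefficient is thus at most `(sup |∂^u f|)² ∏_{j ∈ u} 1/(4 h_j²)`, a multiple of the kernel
coefficient `∏ 1/(2π² h_j²)`. By Parseval the mean square error is at most the sum of squared
coefficients over the nonzero dual lattice (`rmsError_le_of_continuous`), hence at most `S₀` times
the CBC criterion, provided the squared derivative bounds are dominated by `S₀ γ_u`.

CBC. A minimum is at most an average. With subadditivity of `x ↦ x^λ`, `1/2 < λ ≤ 1`, and a count of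
solutions of a linear congruence, the criterion `e` satisfies `φ(n) e^λ ≤ ∑_u γ_u^λ ρ^|u|`, where
`ρ` is the sum of the `λ`-th powers of the kernel coefficients (`IsCBCOutput.card_mul_rpow_le`). For
`n = 2^m`, `φ(n) ≥ n/2`, which gives the rate `n^{-1/(2λ)}` after a square root.

Dimension independence. Put `t_u = (|u|!)^β ∏ κ b_j` and `q = 2λ/(1+λ)`. Since `γ_u` is `t_u^{2-q}`
for one value of `κ`, both the domination of `t_u²` by `γ_u` and the bound on `∑ γ_u^λ ρ^|u|` reduce
to bounding `∑_u t_u^q` uniformly in `s`. As `p ≤ q`, it suffices to take the power `p`. There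
`∑_{|u|=m} ∏ x_j ≤ (∑ x_j)^m / m!` leaves `∑_m (m!)^{βp-1} A^m`, which converges because `βp < 1`
(`exists_sum_gevreyTerm_rpow_le`). -/

namespace LatticeBOED

/-! ### The parameter box -/

section Box

variable {s : ℕ}

lemma paramBox_eq_pi (s : ℕ) :
    paramBox s = Set.univ.pi fun _ => Set.Icc (-(1 / 2) : ℝ) (1 / 2) := by
  rw [paramBox, Set.pi_univ_Icc]

lemma mem_paramBox {x : Fin s → ℝ} :
    x ∈ paramBox s ↔ ∀ j, x j ∈ Set.Icc (-(1 / 2) : ℝ) (1 / 2) := by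
  simp only [paramBox, Set.mem_Icc, Pi.le_def, forall_and]

lemma uniqueDiffOn_paramBox (s : ℕ) : UniqueDiffOn ℝ (paramBox s) := by
  rw [paramBox_eq_pi]
  refine UniqueDiffOn.univ_pi fun _ => ?_
  exact uniqueDiffOn_Icc (by norm_num)

lemma paramBox_subset_closure_interior (s : ℕ) :
    paramBox s ⊆ closure (interior (paramBox s)) := by
  rw [paramBox_eq_pi, interior_pi_set Set.finite_univ, closure_pi_set]
  refine Set.pi_mono fun _ _ => ?_
  rw [interior_Icc, closure_Ioo (by norm_num)]

lemma update_mem_paramBox {x : Fin s → ℝ} (hx : x ∈ paramBox s) (j : Fin s) {t : ℝ}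
    (ht : t ∈ Set.Icc (-(1 / 2) : ℝ) (1 / 2)) : Function.update x j t ∈ paramBox s := by
  rw [mem_paramBox] at hx ⊢
  intro i
  by_cases h : i = j
  · subst h; simpa using ht
  · simpa [h] using hx i

end Box

/-! ### Commuting partial derivatives up to the boundary -/

section Symmetry

variable {s : ℕ} {E : Type*} [NormedAddCommGroup E] [NormedSpace ℝ E]

/-- The first partial derivative in the coordinate direction `j` within the box. -/
noncomputable def coordDeriv (j : Fin s) (F : (Fin s → ℝ) → E) (x : Fin s → ℝ) : E :=
  fderivWithin ℝ F (paramBox s) x (Pi.single j 1)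

lemma coordDeriv_congr (j : Fin s) {F F' : (Fin s → ℝ) → E} (h : Set.EqOn F F' (paramBox s)) :
    Set.EqOn (coordDeriv j F) (coordDeriv j F') (paramBox s) := by
  intro x hx
  rw [coordDeriv, coordDeriv, fderivWithin_congr h (h hx)]

lemma contDiffOn_coordDeriv (j : Fin s) {F : (Fin s → ℝ) → E}
    (hF : ContDiffOn ℝ ∞ F (paramBox s)) : ContDiffOn ℝ ∞ (coordDeriv j F) (paramBox s) := by
  have h := hF.fderivWithin (m := ∞) (uniqueDiffOn_paramBox s) (by simp)
  exact h.clm_apply contDiffOn_const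

/-- Symmetry of the second derivative survives at boundary points because the box lies in the
closure of its interior. -/
lemma coordDeriv_comm (i j : Fin s) {F : (Fin s → ℝ) → E}
    (hF : ContDiffOn ℝ ∞ F (paramBox s)) :
    Set.EqOn (coordDeriv i (coordDeriv j F)) (coordDeriv j (coordDeriv i F)) (paramBox s) := by
  intro x hx
  have hd : DifferentiableWithinAt ℝ (fderivWithin ℝ F (paramBox s)) (paramBox s) x :=
    ((hF.fderivWithin (m := ∞) (uniqueDiffOn_paramBox s) (by simp)).differentiableOn
      (by simp)) x hx
  have key : ∀ a b : Fin s, coordDeriv a (coordDeriv b F) x =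
      fderivWithin ℝ (fderivWithin ℝ F (paramBox s)) (paramBox s) x (Pi.single a 1)
        (Pi.single b 1) := by
    intro a b
    have : coordDeriv b F = fun y => fderivWithin ℝ F (paramBox s) y (Pi.single b 1) := rfl
    rw [this, coordDeriv, fderivWithin_clm_apply (uniqueDiffOn_paramBox s x hx) hd
      (differentiableWithinAt_const _)]
    simp
  rw [key, key]
  exact ((hF x hx).isSymmSndFDerivWithinAt
    (by rw [minSmoothness_of_isRCLikeNormedField]; exact WithTop.coe_le_coe.2 le_top)
    (uniqueDiffOn_paramBox s)
    (paramBox_subset_closure_interior s hx) hx).eq _ _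

/-- Iterated partial derivatives along a list of coordinate directions. -/
noncomputable def coordDerivs (l : List (Fin s)) (F : (Fin s → ℝ) → E) : (Fin s → ℝ) → E :=
  l.foldr coordDeriv F

lemma contDiffOn_coordDerivs (l : List (Fin s)) {F : (Fin s → ℝ) → E}
    (hF : ContDiffOn ℝ ∞ F (paramBox s)) : ContDiffOn ℝ ∞ (coordDerivs l F) (paramBox s) := by
  induction l with
  | nil => exact hF
  | cons a l ih => exact contDiffOn_coordDeriv a ih

lemma coordDerivs_perm {l l' : List (Fin s)} (h : l.Perm l') {F : (Fin s → ℝ) → E}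
    (hF : ContDiffOn ℝ ∞ F (paramBox s)) :
    Set.EqOn (coordDerivs l F) (coordDerivs l' F) (paramBox s) := by
  induction h with
  | nil => exact Set.eqOn_refl _ _
  | cons a _ ih => exact coordDeriv_congr a ih
  | swap a b l => exact coordDeriv_comm _ _ (contDiffOn_coordDerivs l hF)
  | trans _ _ ih1 ih2 => exact ih1.trans ih2

/-- Links the regularity hypothesis, stated with multilinear derivatives, to iterated first order
derivatives, which can be reordered. -/
lemma iteratedFDerivWithin_eq_coordDerivs (l : List (Fin s)) {F : (Fin s → ℝ) → E}
    (hF : ContDiffOn ℝ ∞ F (paramBox s)) {x : Fin s → ℝ} (hx : x ∈ paramBox s) :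
    iteratedFDerivWithin ℝ l.length F (paramBox s) x
      (fun i => Pi.single (l.get i) (1 : ℝ)) = coordDerivs l F x := by
  induction l generalizing x with
  | nil => simp [coordDerivs]
  | cons a l ih =>
    have hd : DifferentiableWithinAt ℝ (iteratedFDerivWithin ℝ l.length F (paramBox s))
        (paramBox s) x :=
      hF.differentiableOn_iteratedFDerivWithin
        (by exact_mod_cast WithTop.coe_lt_coe.2 (ENat.natCast_lt_top _))
        (uniqueDiffOn_paramBox s) x hx
    change fderivWithin ℝ (iteratedFDerivWithin ℝ l.length F (paramBox s)) (paramBox s) x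
      (Pi.single a 1) (fun i => Pi.single (l.get i) (1 : ℝ)) = coordDeriv a (coordDerivs l F) x
    rw [← fderivWithin_continuousMultilinear_apply_const_apply (uniqueDiffOn_paramBox s x hx) hd,
      coordDeriv, fderivWithin_congr (fun y hy => ih hy) (ih hx)]

lemma count_multiIndexDirs (ν : Fin s → ℕ) (j : Fin s) : (multiIndexDirs ν).count j = ν j := by
  rw [multiIndexDirs, List.count_flatMap]
  have : (List.count j ∘ fun j => List.replicate (ν j) j) = fun i => if i = j then ν j else 0 := by
    funext i
    by_cases h : i = j
    · subst h; simp
    · simp [List.count_replicate, h]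
  rw [this, ← List.ofFn_eq_map, List.sum_ofFn]
  simp

/-- The new direction enters at its sorted position rather than at the head, so only a permutation
is available; commuting derivatives make this enough. -/
lemma multiIndexDirs_perm {ν ν' : Fin s → ℕ} {j : Fin s} (h : ν' = ν + Pi.single j 1) :
    (multiIndexDirs ν').Perm (j :: multiIndexDirs ν) := by
  rw [List.perm_iff_count]
  intro a
  rw [count_multiIndexDirs, List.count_cons, count_multiIndexDirs, h]
  by_cases hc : j = a
  · subst hc; simp
  · simp [hc, Ne.symm hc]

lemma partialDerivWithin_eq_coordDerivs (ν : Fin s → ℕ) {F : (Fin s → ℝ) → E}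
    (hF : ContDiffOn ℝ ∞ F (paramBox s)) :
    Set.EqOn (partialDerivWithin F (paramBox s) ν) (coordDerivs (multiIndexDirs ν) F)
      (paramBox s) :=
  fun _ hx => iteratedFDerivWithin_eq_coordDerivs _ hF hx

lemma hasDerivWithinAt_coordDeriv (j : Fin s) {F : (Fin s → ℝ) → E}
    (hF : ContDiffOn ℝ ∞ F (paramBox s)) {x : Fin s → ℝ} (hx : x ∈ paramBox s) :
    HasDerivWithinAt (fun t => F (Function.update x j t)) (coordDeriv j F x)
      (Set.Icc (-(1 / 2)) (1 / 2)) (x j) := by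
  have h1 : HasFDerivWithinAt F (fderivWithin ℝ F (paramBox s) x) (paramBox s)
      (Function.update x j (x j)) := by
    rw [Function.update_eq_self]
    exact (hF.differentiableOn (by simp) x hx).hasFDerivWithinAt
  exact h1.comp_hasDerivWithinAt (x j) (hasDerivAt_update x j (x j)).hasDerivWithinAt
    fun t ht => update_mem_paramBox hx j ht

end Symmetry

/-! ### First order mixed derivatives: product and exponential rules -/

section MixedFamily

variable {s : ℕ}

/-- `D` is a family of first order mixed partial derivatives on the box: the derivative of `D u`
with respect to a coordinate `j ∉ u` is `D (u ∪ {j})`. -/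
def IsMixedFamily (D : Finset (Fin s) → (Fin s → ℝ) → ℝ) : Prop :=
  ∀ u : Finset (Fin s), ∀ j ∉ u, ∀ x ∈ paramBox s,
    HasDerivWithinAt (fun t => D u (Function.update x j t)) (D (insert j u) x)
      (Set.Icc (-(1 / 2)) (1 / 2)) (x j)

/-- The multi-index with entry `1` on `u` and `0` elsewhere. -/
def indicatorIndex (u : Finset (Fin s)) : Fin s → ℕ := fun j => if j ∈ u then 1 else 0

lemma indicatorIndex_insert {u : Finset (Fin s)} {j : Fin s} (hj : j ∉ u) :
    indicatorIndex (insert j u) = indicatorIndex u + Pi.single j 1 := by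
  funext i
  by_cases h : i = j
  · subst h; simp [indicatorIndex, hj]
  · simp [indicatorIndex, h]

/-- The mixed partial derivatives of first order of `F`. -/
noncomputable def mixedDeriv {E : Type*} [NormedAddCommGroup E] [NormedSpace ℝ E]
    (F : (Fin s → ℝ) → E) (u : Finset (Fin s)) : (Fin s → ℝ) → E :=
  partialDerivWithin F (paramBox s) (indicatorIndex u)

lemma hasDerivWithinAt_mixedDeriv {E : Type*} [NormedAddCommGroup E] [NormedSpace ℝ E]
    {F : (Fin s → ℝ) → E} (hF : ContDiffOn ℝ ∞ F (paramBox s))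
    {u : Finset (Fin s)} {j : Fin s} (hj : j ∉ u) {x : Fin s → ℝ} (hx : x ∈ paramBox s) :
    HasDerivWithinAt (fun t => mixedDeriv F u (Function.update x j t))
      (mixedDeriv F (insert j u) x) (Set.Icc (-(1 / 2)) (1 / 2)) (x j) := by
  have e1 : mixedDeriv F (insert j u) x =
      coordDeriv j (coordDerivs (multiIndexDirs (indicatorIndex u)) F) x := by
    rw [mixedDeriv, partialDerivWithin_eq_coordDerivs _ hF hx,
      coordDerivs_perm (multiIndexDirs_perm (indicatorIndex_insert hj)) hF hx]
    rfl
  rw [e1]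
  refine (hasDerivWithinAt_coordDeriv j (contDiffOn_coordDerivs _ hF) hx).congr ?_ ?_
  · intro t ht
    exact partialDerivWithin_eq_coordDerivs _ hF (update_mem_paramBox hx j ht)
  · exact partialDerivWithin_eq_coordDerivs _ hF
      (update_mem_paramBox hx j (mem_paramBox.1 hx j))

lemma mixedDeriv_empty {E : Type*} [NormedAddCommGroup E] [NormedSpace ℝ E]
    (F : (Fin s → ℝ) → E) (x : Fin s → ℝ) : mixedDeriv F ∅ x = F x := by
  have : multiIndexDirs (indicatorIndex (∅ : Finset (Fin s))) = [] := by
    simp [multiIndexDirs, indicatorIndex]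
  rw [mixedDeriv, partialDerivWithin, this]
  simp

lemma isMixedFamily_mixedDeriv {F : (Fin s → ℝ) → ℝ} (hF : ContDiffOn ℝ ∞ F (paramBox s)) :
    IsMixedFamily (mixedDeriv F) :=
  fun _ _ hj _ hx => hasDerivWithinAt_mixedDeriv hF hj hx

/-- The mixed derivatives of a product of two functions with mixed derivatives `D`, `D'`. -/
def mixedMul (D D' : Finset (Fin s) → (Fin s → ℝ) → ℝ) (u : Finset (Fin s)) (x : Fin s → ℝ) : ℝ :=
  ∑ v ∈ u.powerset, D v x * D' (u \ v) x

/-- The hypotheses are local to `x`, `j` and subsets of `u` so that the rule also applies to `fun v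
=> D (insert j v)`, which need not be a mixed family in its own direction `j`. -/
lemma hasDerivWithinAt_mixedMul {D D' : Finset (Fin s) → (Fin s → ℝ) → ℝ}
    {u : Finset (Fin s)} {j : Fin s} (hj : j ∉ u) {x : Fin s → ℝ}
    (hD : ∀ v ⊆ u, HasDerivWithinAt (fun t => D v (Function.update x j t)) (D (insert j v) x)
      (Set.Icc (-(1 / 2)) (1 / 2)) (x j))
    (hD' : ∀ v ⊆ u, HasDerivWithinAt (fun t => D' v (Function.update x j t)) (D' (insert j v) x)
      (Set.Icc (-(1 / 2)) (1 / 2)) (x j)) :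
    HasDerivWithinAt (fun t => mixedMul D D' u (Function.update x j t))
      (mixedMul D D' (insert j u) x) (Set.Icc (-(1 / 2)) (1 / 2)) (x j) := by
  have e : mixedMul D D' (insert j u) x = ∑ v ∈ u.powerset,
      (D (insert j v) x * D' (u \ v) (Function.update x j (x j)) +
        D v (Function.update x j (x j)) * D' (insert j (u \ v)) x) := by
    rw [mixedMul, Finset.sum_powerset_insert hj, Finset.sum_add_distrib, add_comm]
    congr 1
    · refine Finset.sum_congr rfl fun v hv => ?_
      rw [Finset.mem_powerset] at hv
      rw [Function.update_eq_self, Finset.insert_sdiff_insert,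
        Finset.sdiff_insert_of_notMem hj]
    · refine Finset.sum_congr rfl fun v hv => ?_
      rw [Finset.mem_powerset] at hv
      rw [Function.update_eq_self, Finset.insert_sdiff_of_notMem _ fun h => hj (hv h)]
  rw [e]
  refine HasDerivWithinAt.fun_sum fun v hv => ?_
  rw [Finset.mem_powerset] at hv
  exact (hD v hv).mul (hD' _ Finset.sdiff_subset)

lemma IsMixedFamily.mul {D D' : Finset (Fin s) → (Fin s → ℝ) → ℝ} (hD : IsMixedFamily D)
    (hD' : IsMixedFamily D') : IsMixedFamily (mixedMul D D') := fun _ j hj x hx =>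
  hasDerivWithinAt_mixedMul hj
    (fun v hv => hD v j (fun h => hj (hv h)) x hx) (fun v hv => hD' v j (fun h => hj (hv h)) x hx)

/-- The mixed derivatives of `exp ∘ (-Φ)` satisfy the recursion coming from the product rule. -/
lemma mixedFamily_exp_recursion {D E : Finset (Fin s) → (Fin s → ℝ) → ℝ} (hD : IsMixedFamily D)
    (hE : IsMixedFamily E) (h0 : ∀ x ∈ paramBox s, E ∅ x = Real.exp (-D ∅ x))
    (j : Fin s) (u : Finset (Fin s)) (hj : j ∉ u) :
    ∀ x ∈ paramBox s, E (insert j u) x = -mixedMul (fun v => D (insert j v)) E u x := by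
  have hu : ∀ t ∈ Set.Icc (-(1 / 2) : ℝ) (1 / 2),
      UniqueDiffWithinAt ℝ (Set.Icc (-(1 / 2) : ℝ) (1 / 2)) t :=
    uniqueDiffOn_Icc (by norm_num)
  -- The base case is the chain rule. The inductive step differentiates the identity for `u` in a
  -- new direction `i`; derivatives within a nondegenerate interval are unique, so the two
  -- expressions agree.
  induction u using Finset.induction_on with
  | empty =>
    intro x hx
    have h1 := hE ∅ j hj x hx
    have h2 := (hD ∅ j hj x hx).neg.exp
    have h3 := h2.congr (fun t ht => h0 _ (update_mem_paramBox hx j ht))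
      (h0 _ (update_mem_paramBox hx j (mem_paramBox.1 hx j)))
    rw [(hu _ (mem_paramBox.1 hx j)).eq_deriv _ h1 h3]
    simp [mixedMul, h0 x hx]
    ring
  | insert i u hi ih =>
    intro x hx
    have hij : i ≠ j := fun h => hj (by simp [h])
    have hju : j ∉ u := fun h => hj (by simp [h])
    have h1 := hE (insert j u) i (by simp [hij, hi]) x hx
    have h2 := (hasDerivWithinAt_mixedMul (D := fun v => D (insert j v)) (D' := E) hi
      (fun v hv => by
        have := hD (insert j v) i (by simp [hij]; exact fun h => hi (hv h)) x hx
        rwa [Finset.insert_comm] at this)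
      (fun v hv => hE v i (fun h => hi (hv h)) x hx)).neg
    have h3 := h2.congr (fun t ht => ih hju _ (update_mem_paramBox hx i ht))
      (ih hju _ (update_mem_paramBox hx i (mem_paramBox.1 hx i)))
    rw [Finset.insert_comm, (hu _ (mem_paramBox.1 hx i)).eq_deriv _ h1 h3]

end MixedFamily

/-! ### Stability of Gevrey bounds -/

section Gevrey

variable {s : ℕ}

/-- A Gevrey-type bound of order `β` on a family of mixed derivatives on the box. -/
def GevreyBound (β : ℝ) (b : ℕ → ℝ) (A κ : ℝ) (D : Finset (Fin s) → (Fin s → ℝ) → ℝ) : Prop :=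
  ∀ u : Finset (Fin s), ∀ x ∈ paramBox s,
    |D u x| ≤ A * ((u.card.factorial : ℝ) ^ β * κ ^ u.card * ∏ j ∈ u, b j)

lemma prod_mul_prod_sdiff_of_subset {u v : Finset (Fin s)} (h : v ⊆ u) (f : Fin s → ℝ) :
    (∏ j ∈ v, f j) * ∏ j ∈ u \ v, f j = ∏ j ∈ u, f j := by
  rw [mul_comm, Finset.prod_sdiff h]

/-- Each Leibniz term obeys the target bound because `|v|! |u \ v|! ≤ |u|!`; the `2^|u|` terms are
absorbed by doubling `κ`. -/
lemma GevreyBound.mul {β : ℝ} (hβ : 1 ≤ β) {b : ℕ → ℝ} (hb : ∀ j, 0 ≤ b j) {A A' κ : ℝ}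
    (hA : 0 ≤ A) (hA' : 0 ≤ A') (hκ : 0 ≤ κ) {D D' : Finset (Fin s) → (Fin s → ℝ) → ℝ}
    (hD : GevreyBound β b A κ D) (hD' : GevreyBound β b A' κ D') :
    GevreyBound β b (A * A') (2 * κ) (mixedMul D D') := by
  intro u x hx
  have hterm : ∀ v ∈ u.powerset, |D v x * D' (u \ v) x| ≤
      A * A' * ((u.card.factorial : ℝ) ^ β * κ ^ u.card * ∏ j ∈ u, b j) := by
    intro v hv
    rw [Finset.mem_powerset] at hv
    have hcard : (u \ v).card + v.card = u.card := Finset.card_sdiff_add_card_eq_card hv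
    have hpb : ∀ w : Finset (Fin s), 0 ≤ ∏ j ∈ w, b j := fun w =>
      Finset.prod_nonneg fun j _ => hb j
    rw [abs_mul]
    calc |D v x| * |D' (u \ v) x|
        ≤ (A * ((v.card.factorial : ℝ) ^ β * κ ^ v.card * ∏ j ∈ v, b j)) *
          (A' * (((u \ v).card.factorial : ℝ) ^ β * κ ^ (u \ v).card * ∏ j ∈ u \ v, b j)) :=
          mul_le_mul (hD v x hx) (hD' _ x hx) (abs_nonneg _)
            (mul_nonneg hA (mul_nonneg (by positivity) (hpb v)))
      _ = A * A' * (((v.card.factorial : ℝ) * ((u \ v).card.factorial : ℝ)) ^ β * κ ^ u.card *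
          ∏ j ∈ u, b j) := by
          rw [Real.mul_rpow (by positivity) (by positivity), ← hcard, pow_add,
            ← prod_mul_prod_sdiff_of_subset hv]
          ring
      _ ≤ _ := by
          have : (v.card.factorial : ℝ) * ((u \ v).card.factorial : ℝ) ≤ u.card.factorial := by
            rw [← hcard, add_comm]
            exact_mod_cast Nat.le_of_dvd (Nat.factorial_pos _)
              (Nat.factorial_mul_factorial_dvd_factorial_add _ _)
          have := hpb u
          gcongr
  calc |mixedMul D D' u x| ≤ ∑ v ∈ u.powerset, |D v x * D' (u \ v) x| :=
        Finset.abs_sum_le_sum_abs _ _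
    _ ≤ u.powerset.card • (A * A' * ((u.card.factorial : ℝ) ^ β * κ ^ u.card * ∏ j ∈ u, b j)) :=
        Finset.sum_le_card_nsmul _ _ _ hterm
    _ = _ := by
        rw [Finset.card_powerset, nsmul_eq_mul, mul_pow]
        push_cast
        ring

/-- As `β ≥ 1`, the binomial coefficient may be moved inside the power; what remains is `(l+1) m! ≤
(m+1)!`. -/
lemma choose_mul_rpow_factorial_le {β : ℝ} (hβ : 1 ≤ β) {m l : ℕ} (hl : l ≤ m) :
    (m.choose l : ℝ) * (((l + 1).factorial : ℝ) ^ β * ((m - l).factorial : ℝ) ^ β) ≤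
      ((m + 1).factorial : ℝ) ^ β := by
  have hc : (1 : ℝ) ≤ m.choose l := by exact_mod_cast Nat.choose_pos hl
  have h1 : (m.choose l : ℝ) ≤ (m.choose l : ℝ) ^ β := by
    simpa using Real.rpow_le_rpow_of_exponent_le hc hβ
  calc (m.choose l : ℝ) * (((l + 1).factorial : ℝ) ^ β * ((m - l).factorial : ℝ) ^ β)
      ≤ (m.choose l : ℝ) ^ β * (((l + 1).factorial : ℝ) ^ β * ((m - l).factorial : ℝ) ^ β) := by
        gcongr
    _ = ((m.choose l : ℝ) * ((l + 1).factorial * (m - l).factorial)) ^ β := by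
        rw [Real.mul_rpow (by positivity) (by positivity),
          Real.mul_rpow (by positivity) (by positivity)]
    _ ≤ ((m + 1).factorial : ℝ) ^ β := by
        refine Real.rpow_le_rpow (by positivity) ?_ (by linarith)
        have : m.choose l * ((l + 1).factorial * (m - l).factorial) = (l + 1) * m.factorial := by
          rw [Nat.factorial_succ, ← Nat.choose_mul_factorial_mul_factorial hl]
          ring
        rw [Nat.factorial_succ m]
        exact_mod_cast this.le.trans (Nat.mul_le_mul_right _ (by omega))

/-- Strong induction through the product recursion. The factor `1 + A` closes it, since `∑ A
(1+A)^(m-l) = (1+A)^(m+1) - 1`. Nonnegativity of the exponent's potential gives the leading constant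
`1`. -/
lemma GevreyBound.exp {β : ℝ} (hβ : 1 ≤ β) {b : ℕ → ℝ} (hb : ∀ j, 0 ≤ b j) {A κ : ℝ}
    (hA : 0 ≤ A) (hκ : 0 ≤ κ) {D E : Finset (Fin s) → (Fin s → ℝ) → ℝ}
    (hD : IsMixedFamily D) (hE : IsMixedFamily E)
    (h0 : ∀ x ∈ paramBox s, E ∅ x = Real.exp (-D ∅ x)) (hpos : ∀ x ∈ paramBox s, 0 ≤ D ∅ x)
    (hbd : GevreyBound β b A κ D) : GevreyBound β b 1 (κ * (1 + A)) E := by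
  have hpb : ∀ w : Finset (Fin s), 0 ≤ ∏ j ∈ w, b j := fun w =>
    Finset.prod_nonneg fun j _ => hb j
  intro u
  induction u using Finset.strongInduction with
  | H u ih =>
    intro x hx
    rcases u.eq_empty_or_nonempty with rfl | ⟨j, hju⟩
    · rw [h0 x hx, abs_of_pos (Real.exp_pos _)]
      simpa using hpos x hx
    obtain ⟨u', hj, rfl⟩ : ∃ u', j ∉ u' ∧ insert j u' = u :=
      ⟨u.erase j, Finset.notMem_erase j u, Finset.insert_erase hju⟩
    rw [mixedFamily_exp_recursion hD hE h0 j u' hj x hx, abs_neg, Finset.card_insert_of_notMem hj,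
      Finset.prod_insert hj]
    set m := u'.card with hm
    set P := b j * ∏ i ∈ u', b i with hP
    have hPnn : 0 ≤ P := mul_nonneg (hb j) (hpb u')
    let g : ℕ → ℝ := fun l => A * (((l + 1).factorial : ℝ) ^ β * ((m - l).factorial : ℝ) ^ β *
      (κ ^ (l + 1) * (κ * (1 + A)) ^ (m - l)) * P)
    have hterm : ∀ v ∈ u'.powerset, |D (insert j v) x * E (u' \ v) x| ≤ g v.card := by
      intro v hv
      rw [Finset.mem_powerset] at hv
      have hjv : j ∉ v := fun h => hj (hv h)
      have hcard : (u' \ v).card = m - v.card := Finset.card_sdiff_of_subset hv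
      have hss : u' \ v ⊂ insert j u' :=
        lt_of_le_of_lt Finset.sdiff_subset (Finset.ssubset_insert hj)
      have h1 := hbd (insert j v) x hx
      have h2 := ih _ hss x hx
      rw [Finset.card_insert_of_notMem hjv, Finset.prod_insert hjv] at h1
      rw [hcard] at h2
      rw [abs_mul]
      refine (mul_le_mul h1 h2 (abs_nonneg _) (mul_nonneg hA (mul_nonneg (by positivity)
        (mul_nonneg (hb j) (hpb v))))).trans (le_of_eq ?_)
      simp only [g, hP, ← prod_mul_prod_sdiff_of_subset hv (fun i => b i)]
      ring
    calc |mixedMul (fun v => D (insert j v)) E u' x|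
        ≤ ∑ v ∈ u'.powerset, |D (insert j v) x * E (u' \ v) x| := Finset.abs_sum_le_sum_abs _ _
      _ ≤ ∑ v ∈ u'.powerset, g v.card := Finset.sum_le_sum hterm
      _ = ∑ l ∈ Finset.range (m + 1), m.choose l • g l := Finset.sum_powerset_apply_card g
      _ ≤ ∑ l ∈ Finset.range (m + 1), (A * (1 + A) ^ (m - l)) *
            (((m + 1).factorial : ℝ) ^ β * κ ^ (m + 1) * P) := by
          refine Finset.sum_le_sum fun l hl => ?_
          have hl' : l ≤ m := Nat.lt_succ_iff.1 (Finset.mem_range.1 hl)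
          have key := choose_mul_rpow_factorial_le hβ hl'
          have hk : κ ^ (m + 1) = κ ^ (l + 1) * κ ^ (m - l) := by
            rw [← pow_add]; congr 1; omega
          calc m.choose l • g l = ((m.choose l : ℝ) * (((l + 1).factorial : ℝ) ^ β *
                ((m - l).factorial : ℝ) ^ β)) * (A * (1 + A) ^ (m - l) * κ ^ (m + 1) * P) := by
                simp only [g]; rw [nsmul_eq_mul, hk, mul_pow]; ring
            _ ≤ ((m + 1).factorial : ℝ) ^ β * (A * (1 + A) ^ (m - l) * κ ^ (m + 1) * P) := by
                gcongr
            _ = _ := by ring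
      _ = (∑ l ∈ Finset.range (m + 1), A * (1 + A) ^ (m - l)) *
            (((m + 1).factorial : ℝ) ^ β * κ ^ (m + 1) * P) := by rw [Finset.sum_mul]
      _ ≤ (1 + A) ^ (m + 1) * (((m + 1).factorial : ℝ) ^ β * κ ^ (m + 1) * P) := by
          have h1 : ∑ l ∈ Finset.range (m + 1), A * (1 + A) ^ (m - l) =
              (1 + A) ^ (m + 1) - 1 := by
            rw [← Finset.mul_sum]
            have := Finset.sum_range_reflect (fun l => (1 + A) ^ l) (m + 1)
            simp only [Nat.add_sub_cancel] at this
            rw [this, ← mul_geom_sum]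
            ring
          rw [h1]
          gcongr
          linarith
      _ = _ := by rw [mul_pow]; ring

end Gevrey

/-! ### Regularity of the likelihood -/

section Likelihood

variable {s k : ℕ}

lemma gevreyBound_const_sub {β : ℝ} {b : ℕ → ℝ} (hb : ∀ j, 0 ≤ b j) {C K y : ℝ}
    (hK : 0 ≤ K) (hy : |y| ≤ K) {D : Finset (Fin s) → (Fin s → ℝ) → ℝ} (hD : GevreyBound β b C 1 D) :
    GevreyBound β b (K + C) 1 (fun u x => (if u = ∅ then y else 0) - D u x) := by
  intro u x hx
  have h1 := hD u x hx
  have hpb : 0 ≤ ∏ j ∈ u, b j := Finset.prod_nonneg fun j _ => hb j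
  rw [add_mul]
  refine (abs_sub _ _).trans (add_le_add ?_ h1)
  split_ifs with h
  · subst h; simpa using hy
  · simp only [abs_zero]; positivity

lemma isMixedFamily_const_sub (y : ℝ) {D : Finset (Fin s) → (Fin s → ℝ) → ℝ}
    (hD : IsMixedFamily D) : IsMixedFamily (fun u x => (if u = ∅ then y else 0) - D u x) := by
  intro u j hj x hx
  have h := (hD u j hj x hx).const_sub (if u = ∅ then y else 0)
  simpa using h

lemma precNorm_sq {Γ : Matrix (Fin k) (Fin k) ℝ} (hΓ : Γ.PosDef)
    (x : EuclideanSpace ℝ (Fin k)) :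
    precNorm Γ x ^ 2 = ∑ a, ∑ c, Γ⁻¹ a c * (x a * x c) := by
  have hnn : 0 ≤ (fun i => x i) ⬝ᵥ (Γ⁻¹.mulVec fun i => x i) := by
    have := hΓ.inv.posSemidef.dotProduct_mulVec_nonneg (fun i => x i)
    simpa using this
  rw [precNorm, Real.sq_sqrt hnn]
  simp only [dotProduct, Matrix.mulVec, Finset.mul_sum]
  exact Finset.sum_congr rfl fun a _ => Finset.sum_congr rfl fun c _ => by ring

/-- Gevrey regularity of the likelihood, uniformly in the dimension, the data and the design. -/
lemma exists_likelihood_gevreyBound {Ξ : Type*} {Γ : Matrix (Fin k) (Fin k) ℝ} (hΓ : Γ.PosDef)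
    {C β K : ℝ} (hC : 0 ≤ C) (hβ : 1 ≤ β) (hK : 0 ≤ K) {b : ℕ → ℝ} (hb : ∀ j, 0 ≤ b j)
    {G : (s : ℕ) → (Fin s → ℝ) → Ξ → EuclideanSpace ℝ (Fin k)}
    (hG : ParametricRegularity C β b G) :
    ∃ A κ : ℝ, 0 ≤ A ∧ 0 ≤ κ ∧ ∀ (s : ℕ) (ξ : Ξ) (y : EuclideanSpace ℝ (Fin k)),
      (∀ i, y i ∈ Set.Icc (-K) K) →
      ContinuousOn (fun θ => likelihood Γ y (G s θ ξ)) (paramBox s) ∧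
      ∃ E : Finset (Fin s) → (Fin s → ℝ) → ℝ, IsMixedFamily E ∧
        (∀ x ∈ paramBox s, E ∅ x = likelihood Γ y (G s x ξ)) ∧ GevreyBound β b A κ E := by
  set N : ℝ := ∑ a, ∑ c, |Γ⁻¹ a c| with hN
  have hNnn : 0 ≤ N := Finset.sum_nonneg fun _ _ => Finset.sum_nonneg fun _ _ => abs_nonneg _
  set A₀ : ℝ := 1 / 2 * N * ((K + C) * (K + C)) with hA₀
  have hA₀nn : 0 ≤ A₀ := by positivity
  -- Each residual component has Gevrey constant `K + C` and rate `1`. Products double the rate, the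
  -- quadratic form gives `A₀`, and the exponential multiplies the rate by `1 + A₀`.
  refine ⟨|gaussConst Γ|, 2 * 1 * (1 + A₀), abs_nonneg _, by positivity, fun s ξ y hy => ?_⟩
  obtain ⟨hsm, hder⟩ := hG s ξ
  have hsmc : ∀ a, ContDiffOn ℝ ∞ (fun θ => G s θ ξ a) (paramBox s) := fun a =>
    (EuclideanSpace.proj a : EuclideanSpace ℝ (Fin k) →L[ℝ] ℝ).contDiff.comp_contDiffOn hsm
  -- mixed derivatives of the components of `G`
  let DG : Fin k → Finset (Fin s) → (Fin s → ℝ) → ℝ :=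
    fun a u x => mixedDeriv (fun θ => G s θ ξ) u x a
  have hDG : ∀ a, IsMixedFamily (DG a) := by
    intro a u j hj x hx
    have h := hasDerivWithinAt_mixedDeriv hsm hj hx
    exact (EuclideanSpace.proj a :
      EuclideanSpace ℝ (Fin k) →L[ℝ] ℝ).hasFDerivAt.comp_hasDerivWithinAt _ h
  have hDGb : ∀ a, GevreyBound β b C 1 (DG a) := by
    intro a u x hx
    have h := hder x hx (indicatorIndex u)
    have h1 : ∑ j, indicatorIndex u j = u.card := by simp [indicatorIndex]
    have h2 : ∏ j : Fin s, b j ^ indicatorIndex u j = ∏ j ∈ u, b j := by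
      simp [indicatorIndex, pow_ite, Finset.prod_ite_mem]
    rw [h1, h2] at h
    have h3 : |DG a u x| ≤ ‖mixedDeriv (fun θ => G s θ ξ) u x‖ := by
      rw [← Real.norm_eq_abs]
      exact PiLp.norm_apply_le _ a
    refine (h3.trans h).trans (le_of_eq ?_)
    rw [one_pow]; ring
  let H : Fin k → Finset (Fin s) → (Fin s → ℝ) → ℝ :=
    fun a u x => (if u = ∅ then y a else 0) - DG a u x
  have hH : ∀ a, IsMixedFamily (H a) := fun a => isMixedFamily_const_sub _ (hDG a)
  have hHb : ∀ a, GevreyBound β b (K + C) 1 (H a) := fun a =>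
    gevreyBound_const_sub hb hK (abs_le.2 (hy a)) (hDGb a)
  let DΦ : Finset (Fin s) → (Fin s → ℝ) → ℝ :=
    fun u x => 1 / 2 * ∑ a, ∑ c, Γ⁻¹ a c * mixedMul (H a) (H c) u x
  have hDΦ : IsMixedFamily DΦ := by
    intro u j hj x hx
    refine HasDerivWithinAt.const_mul _ (HasDerivWithinAt.fun_sum fun a _ =>
      HasDerivWithinAt.fun_sum fun c _ => HasDerivWithinAt.const_mul _ ?_)
    exact (hH a).mul (hH c) u j hj x hx
  have hDΦb : GevreyBound β b A₀ (2 * 1) DΦ := by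
    intro u x hx
    have hpb : 0 ≤ ∏ j ∈ u, b j := Finset.prod_nonneg fun j _ => hb j
    simp only [DΦ]
    rw [abs_mul, abs_of_pos (by norm_num : (0 : ℝ) < 1 / 2), hA₀, hN, mul_assoc, mul_assoc]
    refine mul_le_mul_of_nonneg_left ?_ (by norm_num)
    rw [Finset.sum_mul]
    refine (Finset.abs_sum_le_sum_abs _ _).trans (Finset.sum_le_sum fun a _ => ?_)
    rw [Finset.sum_mul]
    refine (Finset.abs_sum_le_sum_abs _ _).trans (Finset.sum_le_sum fun c _ => ?_)
    rw [abs_mul]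
    refine mul_le_mul_of_nonneg_left ?_ (abs_nonneg _)
    exact (hHb a).mul hβ hb (by positivity) (by positivity) zero_le_one (hHb c) u x hx
  have hΦ0 : ∀ x, DΦ ∅ x = 1 / 2 * precNorm Γ (y - G s x ξ) ^ 2 := by
    intro x
    simp [DΦ, H, DG, mixedMul, mixedDeriv_empty, precNorm_sq hΓ]
  let e : (Fin s → ℝ) → ℝ := fun x => Real.exp (-DΦ ∅ x)
  have hes : ContDiffOn ℝ ∞ e (paramBox s) := by
    refine ContDiffOn.exp (ContDiffOn.neg ?_)
    have : DΦ ∅ = fun x =>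
        1 / 2 * ∑ a, ∑ c, Γ⁻¹ a c * ((y a - G s x ξ a) * (y c - G s x ξ c)) := by
      funext x
      simp [DΦ, H, DG, mixedMul, mixedDeriv_empty]
    rw [this]
    refine contDiffOn_const.mul (ContDiffOn.sum fun a _ => ContDiffOn.sum fun c _ =>
      contDiffOn_const.mul ?_)
    exact (contDiffOn_const.sub (hsmc a)).mul (contDiffOn_const.sub (hsmc c))
  have hlik : ∀ x, likelihood Γ y (G s x ξ) = gaussConst Γ * e x := by
    intro x
    simp only [likelihood, e, hΦ0]
    congr 2
    ring
  have hEb := GevreyBound.exp hβ hb hA₀nn (by norm_num) hDΦ (isMixedFamily_mixedDeriv hes)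
    (fun x _ => mixedDeriv_empty e x) (fun x _ => by rw [hΦ0]; positivity) hDΦb
  refine ⟨?_, fun u x => gaussConst Γ * mixedDeriv e u x, ?_, ?_, ?_⟩
  · simp only [hlik]
    exact continuousOn_const.mul hes.continuousOn
  · intro u j hj x hx
    exact (isMixedFamily_mixedDeriv hes u j hj x hx).const_mul _
  · intro x _
    simp only [mixedDeriv_empty, hlik]
  · intro u x hx
    rw [abs_mul]
    refine mul_le_mul_of_nonneg_left ?_ (abs_nonneg _)
    simpa using hEb u x hx

end Likelihood

/-! ### Mixed differences and mixed derivatives -/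

section MixedDifference

variable {s : ℕ}

lemma piecewise_mem_paramBox {p q : Fin s → ℝ} (hp : p ∈ paramBox s) (hq : q ∈ paramBox s)
    (w : Finset (Fin s)) : w.piecewise q p ∈ paramBox s := by
  rw [mem_paramBox] at *
  intro i
  by_cases h : i ∈ w
  · simpa [h] using hq i
  · simpa [h] using hp i

/-- Mixed differences are bounded by mixed derivatives. -/
lemma abs_mixedDifference_le {E : Finset (Fin s) → (Fin s → ℝ) → ℝ} (hE : IsMixedFamily E)
    {M : Finset (Fin s) → ℝ} (hM : ∀ u, ∀ x ∈ paramBox s, |E u x| ≤ M u)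
    (u : Finset (Fin s)) :
    ∀ v, Disjoint u v → ∀ p ∈ paramBox s, ∀ q ∈ paramBox s,
      |∑ w ∈ u.powerset, (-1) ^ w.card * E v (w.piecewise q p)| ≤
        M (u ∪ v) * ∏ j ∈ u, |p j - q j| := by
  -- The set `v` records the directions already differentiated. The mean value inequality in
  -- direction `j` trades a difference in `j` for a derivative, moving `j` from `u` to `v`.
  induction u using Finset.induction_on with
  | empty => intro v _ p hp q _; simpa using hM v p hp
  | insert j u hj ih =>
    intro v huv p hp q hq
    rw [Finset.disjoint_insert_left] at huv
    have hpw : ∀ w ∈ u.powerset, ∀ t, w.piecewise q (Function.update p j t) =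
        Function.update (w.piecewise q p) j t := by
      intro w hw t
      have : j ∉ w := fun h => hj (Finset.mem_powerset.1 hw h)
      exact (Finset.update_piecewise_of_notMem _ _ _ this _).symm
    let g : ℝ → ℝ := fun t =>
      ∑ w ∈ u.powerset, (-1) ^ w.card * E v (w.piecewise q (Function.update p j t))
    let g' : ℝ → ℝ := fun t =>
      ∑ w ∈ u.powerset, (-1) ^ w.card * E (insert j v) (w.piecewise q (Function.update p j t))
    have hg : ∀ t ∈ Set.Icc (-(1 / 2) : ℝ) (1 / 2),
        HasDerivWithinAt g (g' t) (Set.Icc (-(1 / 2)) (1 / 2)) t := by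
      intro t ht
      refine HasDerivWithinAt.fun_sum fun w hw => HasDerivWithinAt.const_mul _ ?_
      have hmem := update_mem_paramBox (piecewise_mem_paramBox hp hq w) j ht
      have := hE v j huv.1 _ hmem
      simp only [Function.update_idem, Function.update_self] at this
      simpa only [hpw w hw] using this
    have hg' : ∀ t ∈ Set.Icc (-(1 / 2) : ℝ) (1 / 2),
        ‖g' t‖ ≤ M (insert j u ∪ v) * ∏ i ∈ u, |p i - q i| := by
      intro t ht
      have h := ih (insert j v) (by
        rw [Finset.disjoint_insert_right]; exact ⟨hj, huv.2⟩) _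
        (update_mem_paramBox hp j ht) q hq
      have h1 : ∏ i ∈ u, |Function.update p j t i - q i| = ∏ i ∈ u, |p i - q i| := by
        refine Finset.prod_congr rfl fun i hi => ?_
        have : i ≠ j := fun h => hj (h ▸ hi)
        simp [this]
      rwa [h1, Finset.union_insert, ← Finset.insert_union] at h
    have hmv := (convex_Icc (-(1 / 2) : ℝ) (1 / 2)).norm_image_sub_le_of_norm_hasDerivWithin_le
      hg hg' (mem_paramBox.1 hq j) (mem_paramBox.1 hp j)
    have hsum : ∑ w ∈ (insert j u).powerset, (-1) ^ w.card * E v (w.piecewise q p) =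
        g (p j) - g (q j) := by
      rw [Finset.sum_powerset_insert hj, sub_eq_add_neg, ← Finset.sum_neg_distrib]
      refine congrArg₂ _ (Finset.sum_congr rfl fun w _ => by rw [Function.update_eq_self])
        (Finset.sum_congr rfl fun w hw => ?_)
      have hjw : j ∉ w := fun h => hj (Finset.mem_powerset.1 hw h)
      rw [hpw w hw, Finset.piecewise_insert, Finset.card_insert_of_notMem hjw]
      ring
    rw [hsum, Finset.prod_insert hj]
    refine hmv.trans (le_of_eq ?_)
    rw [Real.norm_eq_abs]
    ring

end MixedDifference

/-! ### Fourier analysis of the shifted lattice rule on the torus -/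

section Torus

attribute [local instance] instMeasureSpaceUnitAddCircle

local instance : Measure.IsAddHaarMeasure (volume : Measure UnitAddCircle) :=
  inferInstanceAs (Measure.IsAddHaarMeasure AddCircle.haarAddCircle)

local instance : IsProbabilityMeasure (volume : Measure UnitAddCircle) :=
  inferInstanceAs (IsProbabilityMeasure AddCircle.haarAddCircle)

open UnitAddTorus

variable {s : ℕ}

/-- The representative in `[0, 1)` of a point of the circle `ℝ / ℤ`. -/
noncomputable def circleRep (x : UnitAddCircle) : ℝ := (AddCircle.equivIco 1 0 x : ℝ)

lemma circleRep_coe (a : ℝ) : circleRep (a : UnitAddCircle) = Int.fract a := by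
  rw [circleRep, AddCircle.coe_equivIco_mk_apply]
  simp

lemma circleRep_mem (x : UnitAddCircle) : circleRep x ∈ Set.Ico (0 : ℝ) 1 := by
  have := (AddCircle.equivIco (1 : ℝ) 0 x).2
  simpa [circleRep] using this

lemma coe_circleRep (x : UnitAddCircle) : (circleRep x : UnitAddCircle) = x :=
  AddCircle.coe_equivIco

lemma measurable_circleRep : Measurable circleRep :=
  measurable_subtype_coe.comp (AddCircle.measurableEquivIco (1 : ℝ) 0).measurable

/-- The point of the box `[-1/2, 1/2]^s` corresponding to a point of the torus. -/
noncomputable def boxRep (x : UnitAddTorus (Fin s)) : Fin s → ℝ := fun j => circleRep (x j) - 1 / 2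

lemma boxRep_mem (x : UnitAddTorus (Fin s)) : boxRep x ∈ paramBox s := by
  rw [mem_paramBox]
  intro j
  have := circleRep_mem (x j)
  constructor <;> simp only [boxRep] <;> linarith [this.1, this.2]

lemma measurable_boxRep : Measurable (boxRep (s := s)) :=
  measurable_pi_lambda _ fun j =>
    (measurable_circleRep.comp (measurable_pi_apply j)).sub_const _

lemma mFourier_add_arg (h : Fin s → ℤ) (x y : UnitAddTorus (Fin s)) :
    mFourier h (x + y) = mFourier h x * mFourier h y := by
  simp only [mFourier, ContinuousMap.coe_mk, ← Finset.prod_mul_distrib]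
  refine Finset.prod_congr rfl fun i _ => ?_
  rw [Pi.add_apply, fourier_apply, fourier_apply, fourier_apply, smul_add,
    AddCircle.toCircle_add]
  simp

lemma mFourier_neg_mul_self (h : Fin s → ℤ) (x : UnitAddTorus (Fin s)) :
    mFourier (-h) x * mFourier h x = 1 := by
  rw [← mFourier_add, neg_add_cancel, mFourier_zero]; rfl

lemma mFourierCoeff_comp_add_right (g : UnitAddTorus (Fin s) → ℂ) (τ : UnitAddTorus (Fin s))
    (h : Fin s → ℤ) :
    mFourierCoeff (fun x => g (x + τ)) h = mFourier h τ * mFourierCoeff g h := by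
  rw [mFourierCoeff, mFourierCoeff,
    ← integral_add_right_eq_self (fun t => mFourier (-h) t • g t) τ, ← integral_const_mul]
  refine integral_congr_ae (Filter.Eventually.of_forall fun x => ?_)
  simp only [smul_eq_mul, mFourier_add_arg]
  have := mFourier_neg_mul_self h τ
  linear_combination (-(mFourier (-h) x) * g (x + τ)) * this

/-- The half period shift for the frequency `h`. -/
noncomputable def halfShift (h : ℤ) : ℝ := 1 / (2 * |(h : ℝ)|)

lemma halfShift_mem {h : ℤ} (hh : h ≠ 0) : halfShift h ∈ Set.Icc (0 : ℝ) (1 / 2) := by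
  have h1 : (1 : ℝ) ≤ |(h : ℝ)| := by exact_mod_cast Int.one_le_abs hh
  refine ⟨by unfold halfShift; positivity, ?_⟩
  unfold halfShift
  exact one_div_le_one_div_of_le (by norm_num) (by linarith)

lemma fourier_halfShift {h : ℤ} (hh : h ≠ 0) :
    fourier h ((halfShift h : ℝ) : UnitAddCircle) = -1 := by
  rw [fourier_coe_apply]
  have h0 : (h : ℝ) ≠ 0 := by exact_mod_cast hh
  rcases lt_or_gt_of_ne hh with hneg | hpos
  · have h1 : |(h : ℝ)| = -h := abs_of_neg (by exact_mod_cast hneg)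
    have : 2 * (Real.pi : ℂ) * Complex.I * h * (halfShift h : ℝ) / (1 : ℝ) =
        -(Real.pi * Complex.I) := by
      have h0' : (h : ℂ) ≠ 0 := by exact_mod_cast hh
      rw [halfShift, h1]
      push_cast
      field_simp
    rw [this, Complex.exp_neg, Complex.exp_pi_mul_I]
    norm_num
  · have h1 : |(h : ℝ)| = h := abs_of_pos (by exact_mod_cast hpos)
    have : 2 * (Real.pi : ℂ) * Complex.I * h * (halfShift h : ℝ) / (1 : ℝ) =
        Real.pi * Complex.I := by
      have h0' : (h : ℂ) ≠ 0 := by exact_mod_cast hh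
      rw [halfShift, h1]
      push_cast
      field_simp
    rw [this, Complex.exp_pi_mul_I]

/-- The variation of the representative under a shift is small in the mean. -/
lemma integral_abs_circleRep_sub_le {t : ℝ} (ht : t ∈ Set.Icc (0 : ℝ) (1 / 2)) :
    ∫ x : UnitAddCircle, |circleRep x - circleRep (x + (t : UnitAddCircle))| ≤ 2 * t := by
  have hmp : MeasurePreserving ((↑) : ℝ → UnitAddCircle) (volume.restrict (Set.Ioc 0 (0 + 1)))
      AddCircle.haarAddCircle := by
    have := AddCircle.measurePreserving_mk 1 0
    simpa [AddCircle.volume_eq_smul_haarAddCircle] using this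
  have hmeas : Measurable fun x : UnitAddCircle =>
      |circleRep x - circleRep (x + (t : UnitAddCircle))| :=
    (measurable_circleRep.sub (measurable_circleRep.comp (measurable_add_const _))).abs
  have e1 : ∫ x : UnitAddCircle, |circleRep x - circleRep (x + (t : UnitAddCircle))| =
      ∫ a in Set.Ioc (0 : ℝ) (0 + 1), |Int.fract a - Int.fract (a + t)| := by
    change ∫ x, _ ∂AddCircle.haarAddCircle = _
    rw [← hmp.map_eq, integral_map hmp.measurable.aemeasurable hmeas.aestronglyMeasurable]
    refine integral_congr_ae (Filter.Eventually.of_forall fun a => ?_)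
    simp only [← AddCircle.coe_add, circleRep_coe]
  rw [e1, zero_add]
  have hint : IntegrableOn (fun a => t + (Set.Icc (1 - t) 1).indicator (fun _ => (1 : ℝ)) a)
      (Set.Ioc 0 1) :=
    (integrable_const t).add ((integrable_const (1 : ℝ)).indicator measurableSet_Icc)
  -- The representatives differ by exactly `t` except on the wrap-around interval of length `t`,
  -- where they differ by at most `1`. Each effect contributes at most `t` to the mean.
  have hb : ∀ a ∈ Set.Ioc (0 : ℝ) 1, |Int.fract a - Int.fract (a + t)| ≤
      t + (Set.Icc (1 - t) 1).indicator (fun _ => (1 : ℝ)) a := by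
    intro a ha
    by_cases h : a < 1 - t
    · have h1 : Int.fract a = a := Int.fract_eq_self.2 ⟨ha.1.le, by linarith [ht.1]⟩
      have h2 : Int.fract (a + t) = a + t :=
        Int.fract_eq_self.2 ⟨by linarith [ht.1, ha.1], by linarith⟩
      have h3 : a ∉ Set.Icc (1 - t) 1 := fun h' => by linarith [h'.1]
      rw [h1, h2, Set.indicator_of_notMem h3]
      simp [abs_of_nonneg ht.1]
    · have h3 : a ∈ Set.Icc (1 - t) 1 := ⟨by linarith, ha.2⟩
      rw [Set.indicator_of_mem h3]
      have h4 : |Int.fract a - Int.fract (a + t)| ≤ 1 := by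
        rw [abs_le]
        constructor <;> linarith [Int.fract_nonneg a, Int.fract_lt_one a,
          Int.fract_nonneg (a + t), Int.fract_lt_one (a + t)]
      linarith [ht.1]
  calc ∫ a in Set.Ioc (0 : ℝ) 1, |Int.fract a - Int.fract (a + t)|
      ≤ ∫ a in Set.Ioc (0 : ℝ) 1, (t + (Set.Icc (1 - t) 1).indicator (fun _ => (1 : ℝ)) a) := by
        refine setIntegral_mono_on ?_ hint measurableSet_Ioc hb
        refine Integrable.mono' hint ?_ ?_
        · exact (measurable_fract.sub (measurable_fract.comp
            (measurable_add_const t))).abs.aestronglyMeasurable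
        · filter_upwards [ae_restrict_mem measurableSet_Ioc] with a ha
          simpa using hb a ha
    _ = t + ∫ a in Set.Ioc (0 : ℝ) 1, (Set.Icc (1 - t) 1).indicator (fun _ => (1 : ℝ)) a := by
        rw [integral_add (integrable_const t)
          ((integrable_const (1 : ℝ)).indicator measurableSet_Icc)]
        simp
    _ ≤ t + t := by
        gcongr
        rw [setIntegral_indicator measurableSet_Icc, setIntegral_const, smul_eq_mul, mul_one]
        calc volume.real (Set.Ioc 0 1 ∩ Set.Icc (1 - t) 1) ≤ volume.real (Set.Icc (1 - t) 1) :=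
              measureReal_mono Set.inter_subset_right (by simp)
          _ = t := by simp [Real.volume_real_Icc, ht.1]
    _ = 2 * t := by ring

/-- The support of a frequency vector. -/
def freqSupport (h : Fin s → ℤ) : Finset (Fin s) := Finset.univ.filter fun j => h j ≠ 0

lemma mem_freqSupport {h : Fin s → ℤ} {j : Fin s} : j ∈ freqSupport h ↔ h j ≠ 0 := by
  simp [freqSupport]

/-- The shift by half a period in the coordinates of `w`. -/
noncomputable def halfShifts (h : Fin s → ℤ) (w : Finset (Fin s)) : UnitAddTorus (Fin s) :=
  fun j => if j ∈ w then ((halfShift (h j) : ℝ) : UnitAddCircle) else 0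

lemma mFourier_halfShifts {h : Fin s → ℤ} {w : Finset (Fin s)} (hw : w ⊆ freqSupport h) :
    mFourier h (halfShifts h w) = (-1) ^ w.card := by
  simp only [mFourier, ContinuousMap.coe_mk]
  have : ∀ i, fourier (h i) (halfShifts h w i) = if i ∈ w then (-1 : ℂ) else 1 := by
    intro i
    by_cases hi : i ∈ w
    · simp only [halfShifts, hi, if_true]
      exact fourier_halfShift (mem_freqSupport.1 (hw hi))
    · simp [halfShifts, hi]
  simp_rw [this]
  simp

/-- The translates of `x` by half periods are the mixed vertices of just two points of the box, as
the mixed difference estimate requires. -/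
lemma boxRep_add_halfShifts {h : Fin s → ℤ} {u w : Finset (Fin s)} (hw : w ⊆ u)
    (x : UnitAddTorus (Fin s)) :
    boxRep (x + halfShifts h w) = w.piecewise (boxRep (x + halfShifts h u)) (boxRep x) := by
  funext j
  by_cases hj : j ∈ w
  · simp [boxRep, halfShifts, hj, hw hj]
  · simp [boxRep, halfShifts, hj]

lemma integrable_comp_boxRep {F : (Fin s → ℝ) → ℝ} (hF : Continuous F) :
    Integrable (fun x : UnitAddTorus (Fin s) => (F (boxRep x) : ℂ)) := by
  obtain ⟨B, hB⟩ := (isCompact_Icc (a := fun _ : Fin s => (-(1 / 2) : ℝ))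
    (b := fun _ => 1 / 2)).exists_bound_of_continuousOn hF.continuousOn
  refine Integrable.of_bound (C := B) ?_ (Filter.Eventually.of_forall fun x => ?_)
  · exact (Complex.measurable_ofReal.comp
      (hF.measurable.comp measurable_boxRep)).aestronglyMeasurable
  · rw [Complex.norm_real]
    exact hB _ (boxRep_mem x)

/-- Decay of the Fourier coefficients of a function with bounded mixed derivatives. -/
lemma norm_mFourierCoeff_le {E : Finset (Fin s) → (Fin s → ℝ) → ℝ} (hE : IsMixedFamily E)
    {M : Finset (Fin s) → ℝ} (hM : ∀ u, ∀ x ∈ paramBox s, |E u x| ≤ M u)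
    {F : (Fin s → ℝ) → ℝ} (hF : Continuous F) (hEF : ∀ x ∈ paramBox s, E ∅ x = F x)
    (h : Fin s → ℤ) :
    ‖mFourierCoeff (fun x => (F (boxRep x) : ℂ)) h‖ ≤
      M (freqSupport h) * ∏ j ∈ freqSupport h, 1 / (2 * |(h j : ℝ)|) := by
  set u := freqSupport h with hu
  set g : UnitAddTorus (Fin s) → ℂ := fun x => (F (boxRep x) : ℂ) with hg
  have hgint : Integrable g := integrable_comp_boxRep hF
  have hMnn : 0 ≤ M u := (abs_nonneg _).trans (hM u (boxRep 0) (boxRep_mem 0))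
  -- the mixed difference along half periods
  let d : UnitAddTorus (Fin s) → ℝ :=
    fun x => ∏ j ∈ u, |boxRep x j - boxRep (x + halfShifts h u) j|
  have hdiff : ∀ x, ‖∑ w ∈ u.powerset, (-1 : ℂ) ^ w.card * g (x + halfShifts h w)‖ ≤
      M u * d x := by
    intro x
    have h1 := abs_mixedDifference_le hE hM u ∅ (Finset.disjoint_empty_right _) (boxRep x)
      (boxRep_mem x) (boxRep (x + halfShifts h u)) (boxRep_mem _)
    rw [Finset.union_empty] at h1
    have h2 : ∑ w ∈ u.powerset, (-1 : ℂ) ^ w.card * g (x + halfShifts h w) =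
        ((∑ w ∈ u.powerset, (-1) ^ w.card *
          E ∅ (w.piecewise (boxRep (x + halfShifts h u)) (boxRep x)) : ℝ) : ℂ) := by
      push_cast
      refine Finset.sum_congr rfl fun w hw => ?_
      rw [hEF _ (piecewise_mem_paramBox (boxRep_mem x) (boxRep_mem _) w), hg]
      simp only
      rw [boxRep_add_halfShifts (Finset.mem_powerset.1 hw)]
    rw [h2, Complex.norm_real]
    exact h1
  -- The integrand is a product over coordinates, and each factor has mean at most `2 * halfShift (h
  -- j) = 1 / |h j|`.
  have hd : ∫ x, d x ≤ ∏ j ∈ u, 1 / |(h j : ℝ)| := by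
    let φ : Fin s → UnitAddCircle → ℝ := fun j y => if j ∈ u then
      |circleRep y - circleRep (y + ((halfShift (h j) : ℝ) : UnitAddCircle))| else 1
    have h1 : d = fun x => ∏ j, φ j (x j) := by
      funext x
      simp only [d, φ]
      rw [Finset.prod_ite_mem, Finset.univ_inter]
      refine Finset.prod_congr rfl fun j hj => ?_
      simp [boxRep, halfShifts, hj]
    rw [h1, integral_fintype_prod_volume_eq_prod, ← Finset.prod_subset (Finset.subset_univ u)]
    · refine Finset.prod_le_prod (fun j hj => ?_) fun j hj => ?_
      · exact integral_nonneg fun y => by simp only [φ, if_pos hj]; exact abs_nonneg _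
      · simp only [φ, if_pos hj]
        refine (integral_abs_circleRep_sub_le (halfShift_mem (mem_freqSupport.1 hj))).trans
          (le_of_eq ?_)
        have : (h j : ℝ) ≠ 0 := by exact_mod_cast mem_freqSupport.1 hj
        have : |(h j : ℝ)| ≠ 0 := abs_ne_zero.2 this
        rw [halfShift]
        field_simp
    · intro j _ hj
      simp [φ, hj]
  have hdint : Integrable d := by
    refine Integrable.of_bound (C := 1) ?_ (Filter.Eventually.of_forall fun x => ?_)
    · refine (Finset.measurable_prod _ fun j _ => ?_).aestronglyMeasurable
      exact (((measurable_pi_apply j).comp measurable_boxRep).sub ((measurable_pi_apply j).comp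
        (measurable_boxRep.comp (measurable_add_const _)))).abs
    · rw [Real.norm_eq_abs, Finset.abs_prod]
      refine Finset.prod_le_one (fun _ _ => abs_nonneg _) fun j _ => ?_
      have h1 := mem_paramBox.1 (boxRep_mem x) j
      have h2 := mem_paramBox.1 (boxRep_mem (x + halfShifts h u)) j
      rw [abs_abs, abs_le]
      constructor <;> linarith [h1.1, h1.2, h2.1, h2.2]
  have hshift : ∀ w, Integrable fun x => g (x + halfShifts h w) := fun w =>
    hgint.comp_add_right _
  -- Translation by the half periods of `w` multiplies the coefficient by `(-1)^|w|`, which cancels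
  -- the sign in the difference: `2^|u|` equal terms remain.
  have hcoeff : mFourierCoeff (fun x => ∑ w ∈ u.powerset,
      (-1 : ℂ) ^ w.card * g (x + halfShifts h w)) h = 2 ^ u.card * mFourierCoeff g h := by
    have hterm : ∀ w ∈ u.powerset, ∫ x, mFourier (-h) x • ((-1 : ℂ) ^ w.card *
        g (x + halfShifts h w)) = mFourierCoeff g h := by
      intro w hw
      have h1 := mFourierCoeff_comp_add_right g (halfShifts h w) h
      rw [mFourier_halfShifts (Finset.mem_powerset.1 hw), mFourierCoeff] at h1
      calc ∫ x, mFourier (-h) x • ((-1 : ℂ) ^ w.card * g (x + halfShifts h w))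
          = (-1 : ℂ) ^ w.card * ∫ x, mFourier (-h) x • g (x + halfShifts h w) := by
            rw [← integral_const_mul]
            refine integral_congr_ae (Filter.Eventually.of_forall fun x => ?_)
            simp only [smul_eq_mul]
            ring
        _ = _ := by
            rw [h1, ← mul_assoc, ← mul_pow]
            norm_num
    rw [mFourierCoeff]
    simp only [Finset.smul_sum]
    rw [integral_finsetSum, Finset.sum_congr rfl hterm, Finset.sum_const, Finset.card_powerset,
      nsmul_eq_mul]
    · push_cast; rfl
    · intro w _
      refine Integrable.bdd_mul (c := 1) ((hshift w).const_mul _)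
        (mFourier (-h)).continuous.aestronglyMeasurable
        (Filter.Eventually.of_forall fun x => ?_)
      exact ((mFourier (-h)).norm_coe_le_norm x).trans mFourier_norm.le
  have hle : ‖mFourierCoeff (fun x => ∑ w ∈ u.powerset,
      (-1 : ℂ) ^ w.card * g (x + halfShifts h w)) h‖ ≤ M u * ∏ j ∈ u, 1 / |(h j : ℝ)| := by
    rw [mFourierCoeff]
    refine (norm_integral_le_of_norm_le (hdint.const_mul (M u))
      (Filter.Eventually.of_forall fun x => ?_)).trans ?_
    · rw [norm_smul]
      have : ‖mFourier (-h) x‖ ≤ 1 := ((mFourier (-h)).norm_coe_le_norm x).trans mFourier_norm.le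
      exact (mul_le_of_le_one_left (norm_nonneg _) this).trans (hdiff x)
    · rw [integral_const_mul]
      exact mul_le_mul_of_nonneg_left hd hMnn
  rw [hcoeff, norm_mul, norm_pow, Complex.norm_ofNat] at hle
  have hfin : ∏ j ∈ u, 1 / (2 * |(h j : ℝ)|) = (∏ j ∈ u, 1 / |(h j : ℝ)|) / 2 ^ u.card := by
    rw [← Finset.prod_const, ← Finset.prod_div_distrib]
    refine Finset.prod_congr rfl fun j _ => ?_
    rw [div_div, mul_comm]
  rw [hfin, ← mul_div_assoc, le_div_iff₀ (by positivity)]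
  linarith

/-- The lattice points as points of the torus. -/
noncomputable def latticeTorusPoint (n : ℕ) (z : Fin s → ℕ) (i : ℕ) : UnitAddTorus (Fin s) :=
  fun j => ((latticePoint n z i j : ℝ) : UnitAddCircle)

lemma coe_fract_unitAddCircle (a : ℝ) :
    ((Int.fract a : ℝ) : UnitAddCircle) = (a : UnitAddCircle) := by
  rw [← circleRep_coe, coe_circleRep]

/-- The pairing of a frequency vector with a generating vector. -/
def freqDot (h : Fin s → ℤ) (z : Fin s → ℕ) : ℤ := ∑ j, h j * (z j : ℤ)

lemma mFourier_latticeTorusPoint (n : ℕ) (z : Fin s → ℕ) (i : ℕ) (h : Fin s → ℤ) :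
    mFourier h (latticeTorusPoint n z i) =
      Complex.exp (2 * Real.pi * Complex.I * (freqDot h z / n)) ^ i := by
  simp only [mFourier, ContinuousMap.coe_mk, latticeTorusPoint, latticePoint,
    coe_fract_unitAddCircle, fourier_coe_apply]
  rw [← Complex.exp_sum, ← Complex.exp_nat_mul]
  congr 1
  simp only [freqDot]
  push_cast
  rw [Finset.sum_div, Finset.mul_sum, Finset.mul_sum]
  refine Finset.sum_congr rfl fun j _ => ?_
  ring

/-- Orthogonality of characters: the average of a character over the lattice points. -/
lemma average_mFourier_latticeTorusPoint {n : ℕ} (hn : 0 < n) (z : Fin s → ℕ) (h : Fin s → ℤ) :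
    1 / (n : ℂ) * ∑ i ∈ Finset.Icc 1 n, mFourier h (latticeTorusPoint n z i) =
      if (n : ℤ) ∣ freqDot h z then 1 else 0 := by
  have hn0 : (n : ℂ) ≠ 0 := by exact_mod_cast hn.ne'
  simp_rw [mFourier_latticeTorusPoint]
  set ζ := Complex.exp (2 * Real.pi * Complex.I * (freqDot h z / n)) with hζ
  have hone : ζ = 1 ↔ (n : ℤ) ∣ freqDot h z := by
    rw [hζ, Complex.exp_eq_one_iff]
    have h2 : (2 * (Real.pi : ℂ) * Complex.I) ≠ 0 := Complex.two_pi_I_ne_zero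
    constructor
    · rintro ⟨m, hm⟩
      refine ⟨m, ?_⟩
      have h3 : (freqDot h z : ℂ) / n = m := by
        rw [mul_comm (m : ℂ)] at hm
        exact mul_left_cancel₀ h2 hm
      rw [div_eq_iff hn0] at h3
      rw [mul_comm]
      exact_mod_cast h3
    · rintro ⟨m, hm⟩
      refine ⟨m, ?_⟩
      rw [hm]
      push_cast
      field_simp
  have hpow : ζ ^ n = 1 := by
    rw [hζ, ← Complex.exp_nat_mul, Complex.exp_eq_one_iff]
    exact ⟨freqDot h z, by field_simp⟩
  have hsum : ∑ i ∈ Finset.Icc 1 n, ζ ^ i = ∑ i ∈ Finset.range n, ζ ^ (i + 1) := by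
    rw [Finset.range_eq_Ico, Finset.sum_Ico_add' (fun i => ζ ^ i) 0 n 1]
    rfl
  rw [hsum]
  split_ifs with hd
  · rw [hone.2 hd]
    simp [hn0]
  · have h1 : ζ ≠ 1 := fun h => hd (hone.1 h)
    simp_rw [pow_succ]
    rw [← Finset.sum_mul, geom_sum_eq h1, hpow]
    simp

/-- Parseval's identity for bounded measurable real functions on the torus. -/
lemma hasSum_sq_norm_mFourierCoeff {g : UnitAddTorus (Fin s) → ℂ} (hg : MemLp g 2) :
    HasSum (fun h => ‖mFourierCoeff g h‖ ^ 2) (∫ x, ‖g x‖ ^ 2) := by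
  have h1 := hasSum_sq_mFourierCoeff (hg.toLp g)
  have h2 : ∀ h, mFourierCoeff (hg.toLp g) h = mFourierCoeff g h := fun h =>
    integral_congr_ae (by filter_upwards [hg.coeFn_toLp] with x hx; rw [hx])
  have h3 : ∫ x, ‖hg.toLp g x‖ ^ 2 = ∫ x, ‖g x‖ ^ 2 :=
    integral_congr_ae (by filter_upwards [hg.coeFn_toLp] with x hx; rw [hx])
  simpa only [h2, h3] using h1

/-- The lattice rule with one shift, as a function of the shift on the torus. -/
noncomputable def torusRule (n : ℕ) (z : Fin s → ℕ) (F : (Fin s → ℝ) → ℝ)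
    (x : UnitAddTorus (Fin s)) : ℝ :=
  1 / (n : ℝ) * ∑ i ∈ Finset.Icc 1 n, F (boxRep (x + latticeTorusPoint n z i))

lemma exists_bound_of_continuous {F : (Fin s → ℝ) → ℝ} (hF : Continuous F) :
    ∃ B, ∀ x ∈ paramBox s, |F x| ≤ B :=
  (isCompact_Icc (a := fun _ : Fin s => (-(1 / 2) : ℝ))
    (b := fun _ => 1 / 2)).exists_bound_of_continuousOn hF.continuousOn

lemma measurable_torusRule (n : ℕ) (z : Fin s → ℕ) {F : (Fin s → ℝ) → ℝ} (hF : Continuous F) :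
    Measurable (torusRule n z F) :=
  (Finset.measurable_sum _ fun _ _ => hF.measurable.comp
    (measurable_boxRep.comp (measurable_add_const _))).const_mul _

lemma abs_torusRule_le {n : ℕ} (hn : 0 < n) (z : Fin s → ℕ) {F : (Fin s → ℝ) → ℝ} {B : ℝ}
    (hB : ∀ x ∈ paramBox s, |F x| ≤ B) (x : UnitAddTorus (Fin s)) : |torusRule n z F x| ≤ B := by
  have hn' : (0 : ℝ) < n := by exact_mod_cast hn
  rw [torusRule, abs_mul, abs_of_pos (by positivity : (0 : ℝ) < 1 / n)]
  have h1 : |∑ i ∈ Finset.Icc 1 n, F (boxRep (x + latticeTorusPoint n z i))| ≤ n * B := by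
    refine (Finset.abs_sum_le_sum_abs _ _).trans
      ((Finset.sum_le_card_nsmul _ _ B fun i _ => hB _ (boxRep_mem _)).trans (le_of_eq ?_))
    simp
  calc 1 / (n : ℝ) * |∑ i ∈ Finset.Icc 1 n, F (boxRep (x + latticeTorusPoint n z i))|
      ≤ 1 / (n : ℝ) * (n * B) := by gcongr
    _ = B := by field_simp

/-- The Fourier coefficients of the error of the shifted lattice rule. -/
lemma norm_mFourierCoeff_torusRule_sub {n : ℕ} (hn : 0 < n) (z : Fin s → ℕ)
    {F : (Fin s → ℝ) → ℝ} (hF : Continuous F) (h : Fin s → ℤ) :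
    ‖mFourierCoeff (fun x => ((torusRule n z F x - ∫ y, F (boxRep y) : ℝ) : ℂ)) h‖ =
      if h ≠ 0 ∧ (n : ℤ) ∣ freqDot h z then
        ‖mFourierCoeff (fun x => (F (boxRep x) : ℂ)) h‖ else 0 := by
  set g : UnitAddTorus (Fin s) → ℂ := fun x => (F (boxRep x) : ℂ) with hg
  have hgint : Integrable g := integrable_comp_boxRep hF
  have hbd : ∀ {k : UnitAddTorus (Fin s) → ℂ}, Integrable k →
      Integrable fun x => mFourier (-h) x • k x := by
    intro k hk
    refine Integrable.bdd_mul (c := 1) hk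
      (mFourier (-h)).continuous.aestronglyMeasurable (Filter.Eventually.of_forall fun x => ?_)
    exact ((mFourier (-h)).norm_coe_le_norm x).trans mFourier_norm.le
  have hsh : ∀ i, Integrable fun x => g (x + latticeTorusPoint n z i) := fun i =>
    hgint.comp_add_right _
  have e1 : mFourierCoeff (fun x => ((torusRule n z F x - ∫ y, F (boxRep y) : ℝ) : ℂ)) h =
      (1 / (n : ℂ) * ∑ i ∈ Finset.Icc 1 n, mFourier h (latticeTorusPoint n z i)) *
        mFourierCoeff g h - mFourierCoeff (fun _ : UnitAddTorus (Fin s) =>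
          ((∫ y, F (boxRep y) : ℝ) : ℂ)) h := by
    have e2 : (fun x => ((torusRule n z F x - ∫ y, F (boxRep y) : ℝ) : ℂ)) = fun x =>
        (∑ i ∈ Finset.Icc 1 n, 1 / (n : ℂ) * g (x + latticeTorusPoint n z i)) -
          ((∫ y, F (boxRep y) : ℝ) : ℂ) := by
      funext x
      simp only [torusRule, hg]
      push_cast
      rw [Finset.mul_sum]
    have e3 : ∀ i, ∫ x, mFourier (-h) x • (1 / (n : ℂ) * g (x + latticeTorusPoint n z i)) =
        1 / (n : ℂ) * (mFourier h (latticeTorusPoint n z i) * mFourierCoeff g h) := by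
      intro i
      rw [← mFourierCoeff_comp_add_right, mFourierCoeff, ← integral_const_mul]
      refine integral_congr_ae (Filter.Eventually.of_forall fun x => ?_)
      simp only [smul_eq_mul]
      ring
    rw [e2, mFourierCoeff]
    simp only [smul_sub, Finset.smul_sum]
    rw [integral_sub, integral_finsetSum, Finset.sum_congr rfl fun i _ => e3 i, Finset.mul_sum,
      Finset.sum_mul]
    · congr 1
      refine Finset.sum_congr rfl fun i _ => ?_
      ring
    · exact fun i _ => hbd ((hsh i).const_mul _)
    · exact integrable_finsetSum _ fun i _ => hbd ((hsh i).const_mul _)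
    · exact hbd (integrable_const _)
  rw [e1, average_mFourier_latticeTorusPoint hn]
  by_cases h0 : h = 0
  · subst h0
    have e4 : mFourierCoeff g 0 = ((∫ y, F (boxRep y) : ℝ) : ℂ) := by
      rw [mFourierCoeff, neg_zero, mFourier_zero]
      simp only [ContinuousMap.one_apply, one_smul, hg]
      exact integral_ofReal
    have e5 : mFourierCoeff (fun _ : UnitAddTorus (Fin s) =>
          ((∫ y, F (boxRep y) : ℝ) : ℂ)) 0 = ((∫ y, F (boxRep y) : ℝ) : ℂ) := by
      rw [mFourierCoeff, neg_zero, mFourier_zero]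
      simp
    simp [e4, e5, freqDot]
  -- A half period shift in a coordinate with nonzero frequency fixes a constant function but
  -- negates its coefficient, which must therefore vanish.
  · have e5 : ∀ c : ℂ, mFourierCoeff (fun _ : UnitAddTorus (Fin s) => c) h = 0 := by
      intro c
      obtain ⟨j, hj⟩ := Function.ne_iff.1 h0
      have h1 := mFourierCoeff_comp_add_right (fun _ : UnitAddTorus (Fin s) => c)
        (halfShifts h {j}) h
      rw [mFourier_halfShifts (by simpa [freqSupport] using hj)] at h1
      simp only [Finset.card_singleton, pow_one] at h1
      linear_combination (1 / 2 : ℂ) * h1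
    rw [e5, sub_zero]
    split_ifs with h1 h2 h2 <;> simp_all

/-- The quotient map from a cube of side length one to the torus preserves the measure. -/
lemma measurePreserving_torusMk (a : ℝ) :
    MeasurePreserving (fun (x : Fin s → ℝ) j => (x j : UnitAddCircle))
      ((volume : Measure (Fin s → ℝ)).restrict (Set.univ.pi fun _ => Set.Icc a (a + 1)))
      (volume : Measure (UnitAddTorus (Fin s))) := by
  have h1 : MeasurePreserving ((↑) : ℝ → UnitAddCircle) (volume.restrict (Set.Icc a (a + 1)))
      AddCircle.haarAddCircle := by
    have := AddCircle.measurePreserving_mk 1 a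
    rw [← Measure.restrict_congr_set Ioc_ae_eq_Icc]
    simpa [AddCircle.volume_eq_smul_haarAddCircle] using this
  have h2 := measurePreserving_pi (fun _ : Fin s => volume.restrict (Set.Icc a (a + 1)))
    (fun _ => AddCircle.haarAddCircle) (fun _ => h1)
  rw [volume_pi, Measure.restrict_pi_pi]
  exact h2

/-- Discards the upper faces, where the fractional part jumps back to zero. -/
lemma ae_lt_right (a : ℝ) :
    ∀ᵐ x ∂((volume : Measure (Fin s → ℝ)).restrict (Set.univ.pi fun _ => Set.Icc a (a + 1))),
      ∀ j, x j ∈ Set.Ico a (a + 1) := by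
  have h : (Set.univ.pi fun _ : Fin s => Set.Ico a (a + 1)) =ᵐ[volume]
      Set.univ.pi fun _ : Fin s => Set.Icc a (a + 1) := by
    rw [volume_pi]
    have := Measure.univ_pi_Ico_ae_eq_Icc (μ := fun _ : Fin s => (volume : Measure ℝ))
      (f := fun _ => a) (g := fun _ => a + 1)
    rwa [← Set.pi_univ_Icc] at this
  rw [← Measure.restrict_congr_set h]
  filter_upwards [ae_restrict_mem (MeasurableSet.univ_pi fun _ => measurableSet_Ico)] with x hx j
  exact hx j (Set.mem_univ j)

/-- The integral over the box is the integral over the torus. -/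
lemma integral_boxRep {F : (Fin s → ℝ) → ℝ} (hF : Continuous F) :
    ∫ x : UnitAddTorus (Fin s), F (boxRep x) = ∫ θ in paramBox s, F θ := by
  have hbox : paramBox s = Set.univ.pi fun _ => Set.Icc (-(1 / 2) : ℝ) (-(1 / 2) + 1) := by
    rw [paramBox_eq_pi]; norm_num
  have hmp := measurePreserving_torusMk (s := s) (-(1 / 2))
  -- Translating by `1/2` makes `boxRep` the identity on the half-open box centred at the origin.
  rw [← integral_add_right_eq_self (fun x : UnitAddTorus (Fin s) => F (boxRep x))
    (fun _ => ((1 / 2 : ℝ) : UnitAddCircle)), ← hmp.map_eq,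
    integral_map hmp.measurable.aemeasurable, hbox]
  · refine integral_congr_ae ?_
    filter_upwards [ae_lt_right (s := s) (-(1 / 2))] with x hx
    congr 1
    funext j
    simp only [boxRep, Pi.add_apply, ← AddCircle.coe_add, circleRep_coe]
    have : Int.fract (x j + 1 / 2) = x j + 1 / 2 :=
      Int.fract_eq_self.2 ⟨by linarith [(hx j).1], by linarith [(hx j).2]⟩
    rw [this]
    ring
  · exact (hF.measurable.comp
      (measurable_boxRep.comp (measurable_add_const _))).aestronglyMeasurable

/-- The law of one shift. -/
noncomputable def singleShiftLaw (s : ℕ) : Measure (Fin s → ℝ) :=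
  (volume : Measure (Fin s → ℝ)).restrict (Set.Icc 0 1)

lemma measurePreserving_singleShift :
    MeasurePreserving (fun (x : Fin s → ℝ) j => (x j : UnitAddCircle))
      (singleShiftLaw s) (volume : Measure (UnitAddTorus (Fin s))) := by
  have h := measurePreserving_torusMk (s := s) 0
  have e : (Set.univ.pi fun _ : Fin s => Set.Icc (0 : ℝ) (0 + 1)) = Set.Icc 0 1 := by
    rw [zero_add, Set.pi_univ_Icc]; rfl
  rwa [e] at h

instance : IsProbabilityMeasure (singleShiftLaw s) := by
  constructor
  have h := (measurePreserving_singleShift (s := s)).measure_preimage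
    MeasurableSet.univ.nullMeasurableSet
  rw [Set.preimage_univ] at h
  rw [h]
  exact measure_univ

lemma shiftLaw_eq (s R : ℕ) : shiftLaw s R = Measure.pi fun _ : Fin R => singleShiftLaw s := rfl

instance (R : ℕ) : IsProbabilityMeasure (shiftLaw s R) := by
  rw [shiftLaw_eq]; infer_instance

lemma cubatureError_eq {n : ℕ} (z : Fin s → ℕ) {R : ℕ} (hR : 0 < R)
    {F : (Fin s → ℝ) → ℝ} (hF : Continuous F) (Δ : Fin R → Fin s → ℝ) :
    cubatureError n z R F Δ = -(1 / (R : ℝ) * ∑ r,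
      (torusRule n z F (fun j => (Δ r j : UnitAddCircle)) -
        ∫ x : UnitAddTorus (Fin s), F (boxRep x))) := by
  have hR' : (R : ℝ) ≠ 0 := by exact_mod_cast hR.ne'
  have h1 : ∀ (r : Fin R) (i : ℕ), (fun j => Int.fract (latticePoint n z i j + Δ r j) - 1 / 2) =
      boxRep ((fun j => (Δ r j : UnitAddCircle)) + latticeTorusPoint n z i) := by
    intro r i
    funext j
    simp only [boxRep, Pi.add_apply, latticeTorusPoint, ← AddCircle.coe_add, circleRep_coe]
    rw [add_comm]
  rw [integral_boxRep hF, Finset.sum_sub_distrib]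
  simp only [cubatureError, shiftedLatticeRule, torusRule, h1, Finset.sum_const,
    Finset.card_univ, Fintype.card_fin, nsmul_eq_mul, ← Finset.mul_sum]
  field_simp
  ring

/-- Both the integral and the sampling points stay inside the box; this permits replacing the
integrand by a globally continuous extension. -/
lemma cubatureError_congr {n : ℕ} (z : Fin s → ℕ) {R : ℕ} {f F : (Fin s → ℝ) → ℝ}
    (h : Set.EqOn f F (paramBox s)) : cubatureError n z R f = cubatureError n z R F := by
  funext Δ
  have h1 : ∀ a : Fin s → ℝ, (fun j => Int.fract (a j) - 1 / 2) ∈ paramBox s := by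
    intro a
    rw [mem_paramBox]
    intro j
    constructor <;> linarith [Int.fract_nonneg (a j), (Int.fract_lt_one (a j)).le]
  simp only [cubatureError, shiftedLatticeRule]
  rw [setIntegral_congr_fun (by rw [paramBox]; exact measurableSet_Icc) h]
  simp only [fun (r : Fin R) (i : ℕ) (Δ : Fin R → Fin s → ℝ) =>
    h (h1 fun j => latticePoint n z i j + Δ r j)]

/-- The root-mean-square error of the randomly shifted lattice rule is controlled by the Fourier
coefficients on the dual lattice. -/
lemma rmsError_le_of_continuous {n : ℕ} (hn : 0 < n) (z : Fin s → ℕ) {R : ℕ} (hR : 0 < R)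
    {F : (Fin s → ℝ) → ℝ} (hF : Continuous F) {c : (Fin s → ℤ) → ℝ} {S : ℝ} (hc : HasSum c S)
    (hc0 : ∀ h, 0 ≤ c h)
    (hle : ∀ h : Fin s → ℤ, h ≠ 0 → (n : ℤ) ∣ freqDot h z →
      ‖mFourierCoeff (fun x => (F (boxRep x) : ℂ)) h‖ ^ 2 ≤ c h) :
    MemLp (cubatureError n z R F) 2 (shiftLaw s R) ∧ rmsError n z R F ≤ Real.sqrt S := by
  have hR' : (0 : ℝ) < R := by exact_mod_cast hR
  obtain ⟨B, hB⟩ := exists_bound_of_continuous hF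
  set I : ℝ := ∫ x : UnitAddTorus (Fin s), F (boxRep x) with hI
  let q : UnitAddTorus (Fin s) → ℝ := fun x => torusRule n z F x - I
  have hqm : Measurable q := (measurable_torusRule n z hF).sub_const _
  have hqb : ∀ x, |q x| ≤ B + |I| := fun x =>
    (abs_sub _ _).trans (add_le_add (abs_torusRule_le hn z hB x) le_rfl)
  let e : (Fin s → ℝ) → ℝ := fun x => q fun j => (x j : UnitAddCircle)
  have hmp := measurePreserving_singleShift (s := s)
  have hem : Measurable e := hqm.comp hmp.measurable
  have herr : cubatureError n z R F = fun Δ => -(1 / (R : ℝ) * ∑ r, e (Δ r)) := by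
    funext Δ
    rw [cubatureError_eq z hR hF]
  have hmeas : Measurable (cubatureError n z R F) := by
    rw [herr]
    exact ((Finset.measurable_sum _ fun r _ => hem.comp (measurable_pi_apply r)).const_mul _).neg
  have hbd : ∀ Δ, ‖cubatureError n z R F Δ‖ ≤ B + |I| := by
    intro Δ
    rw [herr, norm_neg, norm_mul, Real.norm_of_nonneg (by positivity : (0 : ℝ) ≤ 1 / R)]
    have h1 : ‖∑ r, e (Δ r)‖ ≤ R * (B + |I|) := by
      refine (norm_sum_le _ _).trans ((Finset.sum_le_card_nsmul _ _ (B + |I|)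
        fun r _ => hqb _).trans (le_of_eq ?_))
      simp only [Finset.card_univ, Fintype.card_fin, nsmul_eq_mul]
    calc 1 / (R : ℝ) * ‖∑ r, e (Δ r)‖ ≤ 1 / (R : ℝ) * (R * (B + |I|)) := by gcongr
      _ = B + |I| := by field_simp
  refine ⟨MemLp.of_bound hmeas.aestronglyMeasurable _ (Filter.Eventually.of_forall hbd), ?_⟩
  rw [rmsError]
  refine Real.sqrt_le_sqrt ?_
  -- Parseval on the torus
  have hqL : MemLp (fun x => (q x : ℂ)) 2 := by
    refine MemLp.of_bound (Complex.measurable_ofReal.comp hqm).aestronglyMeasurable (B + |I|)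
      (Filter.Eventually.of_forall fun x => ?_)
    rw [Complex.norm_real]
    exact hqb x
  have hpars := hasSum_sq_norm_mFourierCoeff hqL
  have hq2 : ∫ x, q x ^ 2 ≤ S := by
    have h1 : ∫ x, ‖(q x : ℂ)‖ ^ 2 = ∫ x, q x ^ 2 := by
      simp only [Complex.norm_real, Real.norm_eq_abs, sq_abs]
    rw [← h1]
    refine hasSum_le (fun h => ?_) hpars hc
    have h2 := norm_mFourierCoeff_torusRule_sub hn z hF h
    simp only [q, hI]
    rw [h2]
    split_ifs with h3
    · exact hle h h3.1 h3.2
    · simpa using hc0 h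
  have he2 : ∫ x, e x ^ 2 ∂(singleShiftLaw s) = ∫ x, q x ^ 2 := by
    rw [← hmp.map_eq, integral_map hmp.measurable.aemeasurable
      (hqm.pow_const 2).aestronglyMeasurable]
  have heint : ∀ r : Fin R, Integrable (fun Δ : Fin R → Fin s → ℝ => e (Δ r) ^ 2)
      (shiftLaw s R) := by
    intro r
    refine Integrable.of_bound (C := (B + |I|) ^ 2)
      ((hem.comp (measurable_pi_apply r)).pow_const 2).aestronglyMeasurable
      (Filter.Eventually.of_forall fun Δ => ?_)
    rw [norm_pow]
    exact pow_le_pow_left₀ (norm_nonneg _) (hqb _) 2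
  have her : ∀ r : Fin R, ∫ Δ, e (Δ r) ^ 2 ∂(shiftLaw s R) = ∫ x, q x ^ 2 := by
    intro r
    have hev := measurePreserving_eval (fun _ : Fin R => singleShiftLaw s) r
    rw [← he2, ← hev.map_eq, integral_map hev.measurable.aemeasurable
      (hem.pow_const 2).aestronglyMeasurable, shiftLaw_eq]
  calc ∫ Δ, |cubatureError n z R F Δ| ^ 2 ∂(shiftLaw s R)
      ≤ ∫ Δ, 1 / (R : ℝ) * ∑ r, e (Δ r) ^ 2 ∂(shiftLaw s R) := by
        refine integral_mono_of_nonneg (Filter.Eventually.of_forall fun Δ => by positivity)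
          ((integrable_finsetSum _ fun r _ => heint r).const_mul _)
          (Filter.Eventually.of_forall fun Δ => ?_)
        -- Cauchy–Schwarz over the `R` shifts: the mean square of the average is at most the mean
        -- square for one shift, which is the same for every `r`.
        have h1 : (∑ r, e (Δ r)) ^ 2 ≤ R * ∑ r, e (Δ r) ^ 2 := by
          simpa using sq_sum_le_card_mul_sum_sq (s := Finset.univ) (f := fun r => e (Δ r))
        simp only [herr, sq_abs, neg_sq, mul_pow]
        calc (1 / (R : ℝ)) ^ 2 * (∑ r, e (Δ r)) ^ 2
            ≤ (1 / (R : ℝ)) ^ 2 * (R * ∑ r, e (Δ r) ^ 2) := by gcongr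
          _ = 1 / (R : ℝ) * ∑ r, e (Δ r) ^ 2 := by field_simp
    _ = ∫ x, q x ^ 2 := by
        rw [integral_const_mul, integral_finsetSum _ fun r _ => heint r,
          Finset.sum_congr rfl fun r _ => her r]
        simp only [Finset.sum_const, Finset.card_univ, Fintype.card_fin, nsmul_eq_mul]
        field_simp
    _ ≤ S := hq2

/-- The continuous extension of a function on the box by projection onto the box. -/
noncomputable def boxExtend (f : (Fin s → ℝ) → ℝ) (x : Fin s → ℝ) : ℝ :=
  f fun j => max (-(1 / 2)) (min (1 / 2) (x j))

lemma continuous_boxExtend {f : (Fin s → ℝ) → ℝ} (hf : ContinuousOn f (paramBox s)) :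
    Continuous (boxExtend f) := by
  refine hf.comp_continuous (by fun_prop) fun x => ?_
  rw [mem_paramBox]
  exact fun j => ⟨le_max_left _ _, max_le (by norm_num) (min_le_left _ _)⟩

lemma boxExtend_eqOn (f : (Fin s → ℝ) → ℝ) : Set.EqOn f (boxExtend f) (paramBox s) := by
  intro x hx
  rw [mem_paramBox] at hx
  rw [boxExtend]
  congr 1
  funext j
  rw [min_eq_right (hx j).2, max_eq_right (hx j).1]

/-- The root-mean-square error for an integrand with bounded mixed derivatives. -/
lemma rmsError_le {n : ℕ} (hn : 0 < n) (z : Fin s → ℕ) {R : ℕ} (hR : 0 < R)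
    {f : (Fin s → ℝ) → ℝ} (hf : ContinuousOn f (paramBox s))
    {E : Finset (Fin s) → (Fin s → ℝ) → ℝ} (hE : IsMixedFamily E)
    (hEf : ∀ x ∈ paramBox s, E ∅ x = f x)
    {M : Finset (Fin s) → ℝ} (hM : ∀ u, ∀ x ∈ paramBox s, |E u x| ≤ M u)
    {c : (Fin s → ℤ) → ℝ} {S : ℝ} (hc : HasSum c S) (hc0 : ∀ h, 0 ≤ c h)
    (hle : ∀ h : Fin s → ℤ, h ≠ 0 → (n : ℤ) ∣ freqDot h z →
      (M (freqSupport h) * ∏ j ∈ freqSupport h, 1 / (2 * |(h j : ℝ)|)) ^ 2 ≤ c h) :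
    MemLp (cubatureError n z R f) 2 (shiftLaw s R) ∧ rmsError n z R f ≤ Real.sqrt S := by
  have heq := cubatureError_congr (n := n) z (R := R) (boxExtend_eqOn f)
  have hF := continuous_boxExtend hf
  have h := rmsError_le_of_continuous hn z hR hF hc hc0 fun h h0 hd =>
    (pow_le_pow_left₀ (norm_nonneg _) (norm_mFourierCoeff_le hE hM hF
      (fun x hx => (hEf x hx).trans (boxExtend_eqOn f hx)) h) 2).trans (hle h h0 hd)
  rw [rmsError] at h ⊢
  rwa [heq]

end Torus

/-! ### Sums of product functions over integer vectors -/

section ProductSums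

/-- The sum of a product function over integer vectors is the product of the sums. -/
lemma summable_and_tsum_prod {𝕜 : Type*} [NormedField 𝕜] [CompleteSpace 𝕜] (s : ℕ) :
    ∀ a : Fin s → ℤ → 𝕜, (∀ j, Summable fun m => ‖a j m‖) →
      (Summable fun h : Fin s → ℤ => ‖∏ j, a j (h j)‖) ∧
        ∑' h : Fin s → ℤ, ∏ j, a j (h j) = ∏ j, ∑' m, a j m := by
  induction s with
  | zero =>
    intro a _
    refine ⟨(hasSum_fintype _).summable, ?_⟩
    rw [tsum_fintype]
    simp
  | succ s ih =>
    intro a ha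
    obtain ⟨h1, h2⟩ := ih (fun j => a j.succ) fun j => ha j.succ
    let e := Fin.consEquiv fun _ : Fin (s + 1) => ℤ
    have hcomp : ∀ x : ℤ × (Fin s → ℤ), ∏ j, a j (e x j) =
        a 0 x.1 * ∏ j : Fin s, a j.succ (x.2 j) := by
      intro x
      rw [Fin.prod_univ_succ]
      simp [e]
    constructor
    · rw [← e.summable_iff]
      refine (Summable.mul_norm (ha 0) h1).congr fun x => ?_
      simp only [Function.comp, hcomp]
    · rw [← e.tsum_eq]
      simp only [hcomp]
      rw [← tsum_mul_tsum_of_summable_norm (ha 0) h1, h2, Fin.prod_univ_succ]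

lemma hasSum_prod_of_norm {𝕜 : Type*} [NormedField 𝕜] [CompleteSpace 𝕜] {s : ℕ}
    {a : Fin s → ℤ → 𝕜} {S : Fin s → 𝕜} (ha : ∀ j, Summable fun m => ‖a j m‖)
    (hS : ∀ j, HasSum (a j) (S j)) :
    HasSum (fun h : Fin s → ℤ => ∏ j, a j (h j)) (∏ j, S j) := by
  obtain ⟨h1, h2⟩ := summable_and_tsum_prod s a ha
  rw [Finset.prod_congr rfl fun j _ => (hS j).tsum_eq.symm, ← h2]
  exact h1.of_norm.hasSum

/-- The sum of a product function over integer vectors, for extended nonnegative values. -/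
lemma ennreal_tsum_prod (s : ℕ) :
    ∀ a : Fin s → ℤ → ENNReal,
      ∑' h : Fin s → ℤ, ∏ j, a j (h j) = ∏ j, ∑' m, a j m := by
  induction s with
  | zero =>
    intro a
    rw [tsum_fintype]
    simp
  | succ s ih =>
    intro a
    let e := Fin.consEquiv fun _ : Fin (s + 1) => ℤ
    have hcomp : ∀ x : ℤ × (Fin s → ℤ), ∏ j, a j (e x j) =
        a 0 x.1 * ∏ j : Fin s, a j.succ (x.2 j) := by
      intro x
      rw [Fin.prod_univ_succ]
      simp [e]
    rw [← e.tsum_eq, Fin.prod_univ_succ, ← ih, ENNReal.tsum_prod']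
    simp only [hcomp]
    simp_rw [ENNReal.tsum_mul_left]
    rw [ENNReal.tsum_mul_right]

end ProductSums

/-! ### Dual lattice expansion of the Bernoulli kernel -/

section Kernel

open UnitAddTorus

/-- The Fourier coefficients of the Bernoulli polynomial of degree two. -/
noncomputable def bernCoeff (m : ℤ) : ℝ := 1 / (2 * Real.pi ^ 2 * (m : ℝ) ^ 2)

-- Division by zero yields the right value here: the degree two Bernoulli polynomial has mean zero.
@[simp] lemma bernCoeff_zero : bernCoeff 0 = 0 := by simp [bernCoeff]

lemma bernCoeff_nonneg (m : ℤ) : 0 ≤ bernCoeff m := by unfold bernCoeff; positivity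

lemma hasSum_bernCoeff_mul_fourier {x : ℝ} (hx : x ∈ Set.Icc (0 : ℝ) 1) :
    HasSum (fun m : ℤ => (bernCoeff m : ℂ) * fourier m (x : UnitAddCircle))
      (bernoulliFun 2 x : ℂ) := by
  have hπ : (Real.pi : ℂ) ≠ 0 := by exact_mod_cast Real.pi_ne_zero
  have h := (hasSum_one_div_pow_mul_fourier_mul_bernoulliFun (k := 2) le_rfl hx).mul_left
    (1 / (2 * (Real.pi : ℂ) ^ 2))
  convert! h using 1
  · funext m
    rw [bernCoeff]
    push_cast
    rw [← mul_assoc, one_div_mul_one_div]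
  · have hI : Complex.I ^ 2 = -1 := Complex.I_sq
    rw [mul_pow, mul_pow, hI]
    norm_num
    field_simp
    ring

/-- The terms are multiples of `|m|^(-2λ)`, whence the restriction `λ > 1/2`. -/
lemma summable_bernCoeff_rpow {lam : ℝ} (hlam : 1 / 2 < lam) :
    Summable fun m : ℤ => bernCoeff m ^ lam := by
  have h : Summable fun m : ℤ => |(m : ℝ)| ^ (-(2 * lam)) := by
    rw [summable_int_iff_summable_nat_and_neg]
    have : Summable fun m : ℕ => (m : ℝ) ^ (-(2 * lam)) :=
      Real.summable_nat_rpow.2 (by linarith)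
    constructor <;> simpa using this
  refine (h.mul_left ((1 / (2 * Real.pi ^ 2)) ^ lam)).congr fun m => ?_
  rw [bernCoeff, Real.rpow_neg (abs_nonneg _), Real.rpow_mul (abs_nonneg _), Real.rpow_two, sq_abs,
    ← Real.inv_rpow (by positivity), ← Real.mul_rpow (by positivity) (by positivity)]
  congr 1
  rw [one_div, one_div, mul_inv (2 * Real.pi ^ 2)]

lemma summable_bernCoeff : Summable bernCoeff := by
  simpa using summable_bernCoeff_rpow (lam := 1) (by norm_num)

variable {s : ℕ}

/-- The factors of the product describing frequencies with support `u`. -/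
noncomputable def supportFactor {R : Type*} [Zero R] [One R] (u : Finset (Fin s)) (r : ℤ → R)
    (j : Fin s) (m : ℤ) : R :=
  if j ∈ u then r m else if m = 0 then 1 else 0

/-- Encodes the condition that `h` has support `u` as a product over all coordinates, so that sums
over frequency vectors factorise. -/
lemma prod_supportFactor {R : Type*} [CommSemiring R] (u : Finset (Fin s)) {r : ℤ → R}
    (hr : r 0 = 0) (h : Fin s → ℤ) :
    ∏ j, supportFactor u r j (h j) = if freqSupport h = u then ∏ j ∈ u, r (h j) else 0 := by
  split_ifs with hu
  · subst hu
    rw [← Finset.prod_subset (Finset.subset_univ (freqSupport h))]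
    · exact Finset.prod_congr rfl fun j hj => by simp only [supportFactor, if_pos hj]
    · intro j _ hj
      have : h j = 0 := by simpa [mem_freqSupport] using hj
      simp [supportFactor, hj, this]
  · obtain ⟨j, hj⟩ : ∃ j, ¬ (j ∈ freqSupport h ↔ j ∈ u) := by
      by_contra! hc
      exact hu (Finset.ext hc)
    refine Finset.prod_eq_zero (Finset.mem_univ j) ?_
    rw [mem_freqSupport] at hj
    by_cases hju : j ∈ u
    · have : h j = 0 := by
        by_contra hne
        exact hj ⟨fun _ => hju, fun _ => hne⟩
      simp [supportFactor, hju, this, hr]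
    · have : h j ≠ 0 := by
        intro h0
        exact hj ⟨fun hne => absurd h0 hne, fun h' => absurd h' hju⟩
      simp [supportFactor, hju, this]

/-- The average over the lattice points of a product of Bernoulli polynomials. -/
noncomputable def latticeBernAvg (n : ℕ) (u : Finset (Fin s)) (z : Fin s → ℕ) : ℝ :=
  1 / (n : ℝ) * ∑ i ∈ Finset.Icc 1 n, ∏ j ∈ u, bernoulliFun 2 (latticePoint n z i j)

/-- The dual lattice expansion of the squared shift-averaged worst-case error. -/
lemma hasSum_latticeBernAvg {n : ℕ} (hn : 0 < n) (u : Finset (Fin s)) (z : Fin s → ℕ) :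
    HasSum (fun h : Fin s → ℤ =>
      if (n : ℤ) ∣ freqDot h z then ∏ j, supportFactor u bernCoeff j (h j) else 0)
      (latticeBernAvg n u z) := by
  have h1 : ∀ i, HasSum (fun h : Fin s → ℤ =>
      ((∏ j, supportFactor u bernCoeff j (h j) : ℝ) : ℂ) * mFourier h (latticeTorusPoint n z i))
      ((∏ j ∈ u, bernoulliFun 2 (latticePoint n z i j) : ℝ) : ℂ) := by
    intro i
    have hx : ∀ j, latticePoint n z i j ∈ Set.Icc (0 : ℝ) 1 := fun j =>
      ⟨Int.fract_nonneg _, (Int.fract_lt_one _).le⟩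
    have h2 : ∀ j, HasSum (fun m : ℤ => ((supportFactor u bernCoeff j m : ℝ) : ℂ) *
        fourier m (latticeTorusPoint n z i j))
        (if j ∈ u then (bernoulliFun 2 (latticePoint n z i j) : ℂ) else 1) := by
      intro j
      by_cases hj : j ∈ u
      · simp only [supportFactor, hj, if_true]
        exact hasSum_bernCoeff_mul_fourier (hx j)
      · simp only [supportFactor, hj, if_false]
        convert! hasSum_ite_eq (0 : ℤ) (1 : ℂ) using 2 with m
        split_ifs with hm <;> simp [hm]
    have h3 : ∀ j, Summable fun m : ℤ => ‖((supportFactor u bernCoeff j m : ℝ) : ℂ) *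
        fourier m (latticeTorusPoint n z i j)‖ := by
      intro j
      have hnorm : ∀ m : ℤ, ‖((supportFactor u bernCoeff j m : ℝ) : ℂ) *
          fourier m (latticeTorusPoint n z i j)‖ = |supportFactor u bernCoeff j m| := by
        intro m
        rw [norm_mul, Complex.norm_real, fourier_apply, Circle.norm_coe, mul_one, Real.norm_eq_abs]
      simp only [hnorm]
      by_cases hj : j ∈ u
      · simp only [supportFactor, hj, if_true]
        exact summable_bernCoeff.abs
      · simp only [supportFactor, hj, if_false]
        exact (hasSum_ite_eq (0 : ℤ) (1 : ℝ)).summable.abs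
    have h4 := hasSum_prod_of_norm h3 h2
    convert! h4 using 1
    · funext h
      rw [Finset.prod_mul_distrib]
      push_cast
      rfl
    · rw [Finset.prod_ite_mem, Finset.univ_inter]
      push_cast
      rfl
  have h5 := (hasSum_sum (s := Finset.Icc 1 n) fun i _ => h1 i).mul_left (1 / (n : ℂ))
  rw [← Complex.hasSum_ofReal]
  convert! h5 using 1
  · funext h
    rw [← Finset.mul_sum, mul_left_comm, average_mFourier_latticeTorusPoint hn]
    split_ifs <;> simp
  · rw [latticeBernAvg]
    push_cast
    rfl

lemma prod_supportFactor_nonneg (u : Finset (Fin s)) (h : Fin s → ℤ) :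
    0 ≤ ∏ j, supportFactor u bernCoeff j (h j) := by
  refine Finset.prod_nonneg fun j _ => ?_
  unfold supportFactor
  split_ifs
  · exact bernCoeff_nonneg _
  · exact zero_le_one
  · exact le_rfl

lemma latticeBernAvg_nonneg {n : ℕ} (hn : 0 < n) (u : Finset (Fin s)) (z : Fin s → ℕ) :
    0 ≤ latticeBernAvg n u z := by
  refine (hasSum_latticeBernAvg hn u z).nonneg fun h => ?_
  split_ifs
  · exact prod_supportFactor_nonneg u h
  · exact le_rfl

end Kernel

/-! ### Subadditivity of powers with exponent at most one -/

section Jensen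

lemma ennreal_rpow_sum_le {ι : Type*} (t : Finset ι) (f : ι → ENNReal) {lam : ℝ} (h0 : 0 < lam)
    (h1 : lam ≤ 1) : (∑ i ∈ t, f i) ^ lam ≤ ∑ i ∈ t, f i ^ lam := by
  classical
  induction t using Finset.induction_on with
  | empty => simp [h0]
  | insert a t ha ih =>
    rw [Finset.sum_insert ha, Finset.sum_insert ha]
    exact (ENNReal.rpow_add_le_add_rpow _ _ h0.le h1).trans (by gcongr)

lemma ennreal_rpow_tsum_le {ι : Type*} (f : ι → ENNReal) {lam : ℝ} (h0 : 0 < lam)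
    (h1 : lam ≤ 1) : (∑' i, f i) ^ lam ≤ ∑' i, f i ^ lam := by
  rw [← ENNReal.le_rpow_inv_iff h0]
  refine ENNReal.summable.tsum_le_of_sum_le fun t => ?_
  rw [ENNReal.le_rpow_inv_iff h0]
  exact (ennreal_rpow_sum_le t f h0 h1).trans (ENNReal.sum_le_tsum t)

lemma real_rpow_sum_le {ι : Type*} (t : Finset ι) {f : ι → ℝ} (hf : ∀ i ∈ t, 0 ≤ f i) {lam : ℝ}
    (h0 : 0 < lam) (h1 : lam ≤ 1) : (∑ i ∈ t, f i) ^ lam ≤ ∑ i ∈ t, f i ^ lam := by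
  classical
  induction t using Finset.induction_on with
  | empty => simp [h0.ne']
  | insert a t ha ih =>
    rw [Finset.sum_insert ha, Finset.sum_insert ha]
    have hft : ∀ i ∈ t, 0 ≤ f i := fun i hi => hf i (Finset.mem_insert_of_mem hi)
    exact (Real.rpow_add_le_add_rpow (hf a (Finset.mem_insert_self a t))
      (Finset.sum_nonneg hft) h0.le h1).trans (by gcongr; exact ih hft)

end Jensen

/-! ### Counting candidates that solve a congruence -/

section Counting

/-- The interval consists of `g` full periods modulo `r`, each containing one element of the class.
-/
lemma card_filter_modEq_le {n r : ℕ} (hr : 0 < r) {g : ℕ} (hg : n = r * g) (v : ℕ) :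
    ((Finset.Icc 1 n).filter fun w => w ≡ v [MOD r]).card ≤ g := by
  have h := Nat.Ioc_filter_modEq_card 0 n hr v
  have hI : Finset.Ioc 0 n = Finset.Icc 1 n := rfl
  rw [hI] at h
  have hr' : (r : ℚ) ≠ 0 := by exact_mod_cast hr.ne'
  have e : ((n : ℚ) - v) / r = ((0 : ℕ) - (v : ℚ)) / r + (g : ℤ) := by
    rw [hg]; push_cast; field_simp; ring
  rw [e, Int.floor_add_intCast] at h
  have : max (⌊((0 : ℕ) - (v : ℚ)) / r⌋ + (g : ℤ) - ⌊((0 : ℕ) - (v : ℚ)) / r⌋) 0 = g := by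
    rw [add_sub_cancel_left]
    exact max_eq_left (by positivity)
  rw [this] at h
  exact_mod_cast h.le

/-- The candidates solving a linear congruence. -/
def congruenceSolutions (n : ℕ) (m a : ℤ) : Finset ℕ :=
  (cbcCandidates n).filter fun w => (n : ℤ) ∣ m * w + a

/-- Candidates are units modulo `n`, so `m` and `m * w ≡ -a` have the same common divisor with `n`.
-/
lemma gcd_eq_of_mem_congruenceSolutions {n : ℕ} {m a : ℤ} {w : ℕ}
    (hw : w ∈ congruenceSolutions n m a) : Int.gcd m n = Int.gcd a n := by
  rw [congruenceSolutions, Finset.mem_filter, cbcCandidates, Finset.mem_filter] at hw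
  obtain ⟨⟨-, hc⟩, c, hd⟩ := hw
  have h1 : Int.gcd (m * w) n = Int.gcd m n := by
    rw [Int.gcd_eq_natAbs, Int.gcd_eq_natAbs, Int.natAbs_mul, Int.natAbs_natCast,
      Int.natAbs_natCast]
    exact Nat.Coprime.gcd_mul_right_cancel _ hc
  have h2 : a = -(m * w) + (n : ℤ) * c := by linarith
  rw [← h1, h2, Int.gcd_add_mul_left_left, Int.neg_gcd]

/-- After division by `g = gcd(m, n)` the coefficient is a unit modulo `n / g`, so any two solutions
agree modulo `n / g`. -/
lemma card_congruenceSolutions_le {n : ℕ} (hn : 0 < n) (m a : ℤ) :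
    (congruenceSolutions n m a).card ≤ Int.gcd m n := by
  rcases (congruenceSolutions n m a).eq_empty_or_nonempty with h | ⟨v, hv⟩
  · simp [h]
  set g := Int.gcd m n with hg
  have hgpos : 0 < g := Int.gcd_pos_of_ne_zero_right _ (by exact_mod_cast hn.ne')
  obtain ⟨r, hr⟩ : g ∣ n := by exact_mod_cast Int.gcd_dvd_right m n
  obtain ⟨m', hm'⟩ : (g : ℤ) ∣ m := Int.gcd_dvd_left m n
  have hrpos : 0 < r := Nat.pos_of_ne_zero fun h0 => by simp [h0] at hr; omega
  have hcop : Int.gcd m' r = 1 := by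
    have h1 : Int.gcd m n = g * Int.gcd m' r := by
      conv_lhs => rw [hm', hr]
      push_cast
      rw [Int.gcd_mul_left]
      simp
    rw [← hg] at h1
    exact Nat.eq_of_mul_eq_mul_left hgpos (by rw [← h1, mul_one])
  refine (Finset.card_le_card ?_).trans (card_filter_modEq_le (n := n) hrpos
    (by rw [hr, mul_comm]) v)
  intro w hw
  have hvd := (Finset.mem_filter.1 hv).2
  have hwd := (Finset.mem_filter.1 hw).2
  have hwI := (Finset.mem_filter.1 (Finset.mem_filter.1 hw).1).1
  rw [Finset.mem_filter]
  refine ⟨hwI, ?_⟩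
  have h2 : (n : ℤ) ∣ m * (v - w) := by
    have := dvd_sub hvd hwd
    rwa [add_sub_add_right_eq_sub, ← mul_sub] at this
  rw [hm', hr, mul_assoc] at h2
  push_cast at h2
  have h3 : (r : ℤ) ∣ m' * (v - w) :=
    (mul_dvd_mul_iff_left (by exact_mod_cast hgpos.ne' : (g : ℤ) ≠ 0)).1 h2
  have h4 : (r : ℤ) ∣ v - w := by
    refine Int.dvd_of_dvd_mul_right_of_gcd_one h3 ?_
    rwa [Int.gcd_comm]
  exact (Nat.modEq_iff_dvd).2 h4

/-- Powers of the Fourier coefficients of the Bernoulli polynomial, as extended reals. -/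
noncomputable def bernPow (lam : ℝ) (m : ℤ) : ENNReal := ENNReal.ofReal (bernCoeff m ^ lam)

/-- Scaling a frequency by `g` gains `g^(-2λ)`, which pays for `g` solutions because `2λ > 1`. -/
lemma bernPow_mul_le {lam : ℝ} (hlam : 1 / 2 < lam) {g : ℕ} (hg : 0 < g) (m : ℤ) :
    bernPow lam (g * m) * g ≤ bernPow lam m := by
  have hg1 : (1 : ℝ) ≤ g := by exact_mod_cast hg
  have hgpos : (0 : ℝ) < g := by linarith
  rw [bernPow, bernPow, ← ENNReal.ofReal_natCast, ← ENNReal.ofReal_mul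
    (Real.rpow_nonneg (bernCoeff_nonneg _) _)]
  refine ENNReal.ofReal_le_ofReal ?_
  have e : bernCoeff (g * m) = (g : ℝ) ^ (-2 : ℝ) * bernCoeff m := by
    rw [bernCoeff, bernCoeff, Real.rpow_neg hgpos.le, Real.rpow_two]
    push_cast
    rw [one_div, one_div, ← mul_inv]
    congr 1
    ring
  rw [e, Real.mul_rpow (by positivity) (bernCoeff_nonneg _), ← Real.rpow_mul hgpos.le]
  have h1 : (g : ℝ) ^ (-2 * lam) * g ≤ 1 := by
    nth_rewrite 2 [← Real.rpow_one (g : ℝ)]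
    rw [← Real.rpow_add hgpos]
    exact Real.rpow_le_one_of_one_le_of_nonpos hg1 (by linarith)
  have h2 : 0 ≤ bernCoeff m ^ lam := Real.rpow_nonneg (bernCoeff_nonneg _) _
  nlinarith

/-- Averaging over the candidates does not increase the sum over the frequencies. -/
lemma tsum_bernPow_mul_card_le {n : ℕ} (hn : 0 < n) {lam : ℝ} (hlam : 1 / 2 < lam) (a : ℤ) :
    ∑' m : ℤ, bernPow lam m * (congruenceSolutions n m a).card ≤ ∑' m : ℤ, bernPow lam m := by
  set g := Int.gcd a n with hg
  have hgpos : 0 < g := Int.gcd_pos_of_ne_zero_right _ (by exact_mod_cast hn.ne')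
  have hinj : Function.Injective fun m : ℤ => (g : ℤ) * m :=
    mul_right_injective₀ (by exact_mod_cast hgpos.ne')
  have hsupp : Function.support (fun m : ℤ => bernPow lam m * (congruenceSolutions n m a).card) ⊆
      Set.range fun m : ℤ => (g : ℤ) * m := by
    intro m hm
    rw [Function.mem_support] at hm
    have hne : (congruenceSolutions n m a).Nonempty := by
      rw [← Finset.card_pos]
      refine Nat.pos_of_ne_zero fun h0 => hm ?_
      simp [h0]
    obtain ⟨w, hw⟩ := hne
    obtain ⟨m', hm'⟩ : (g : ℤ) ∣ m := by
      rw [hg, ← gcd_eq_of_mem_congruenceSolutions hw]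
      exact Int.gcd_dvd_left m n
    exact ⟨m', hm'.symm⟩
  rw [← hinj.tsum_eq hsupp]
  refine ENNReal.tsum_le_tsum fun m => ?_
  refine le_trans ?_ (bernPow_mul_le hlam hgpos m)
  gcongr
  rcases (congruenceSolutions n (g * m) a).eq_empty_or_nonempty with h | ⟨w, hw⟩
  · simp [h]
  · exact (card_congruenceSolutions_le hn _ a).trans (gcd_eq_of_mem_congruenceSolutions hw).le

end Counting

/-! ### Averaging the kernel over one component -/

section Averaging

variable {s : ℕ}

lemma ofReal_latticeBernAvg_rpow_le {n : ℕ} (hn : 0 < n) (u : Finset (Fin s)) (z : Fin s → ℕ)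
    {lam : ℝ} (h0 : 0 < lam) (h1 : lam ≤ 1) :
    ENNReal.ofReal (latticeBernAvg n u z ^ lam) ≤ ∑' h : Fin s → ℤ,
      if (n : ℤ) ∣ freqDot h z then ∏ j, supportFactor u (bernPow lam) j (h j) else 0 := by
  have hs := hasSum_latticeBernAvg hn u z
  have hnn : ∀ h : Fin s → ℤ, 0 ≤ (if (n : ℤ) ∣ freqDot h z then
      ∏ j, supportFactor u bernCoeff j (h j) else 0) := by
    intro h
    split_ifs
    · exact prod_supportFactor_nonneg u h
    · exact le_rfl
  rw [← ENNReal.ofReal_rpow_of_nonneg (latticeBernAvg_nonneg hn u z) h0.le, ← hs.tsum_eq,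
    ENNReal.ofReal_tsum_of_nonneg hnn hs.summable]
  refine (ennreal_rpow_tsum_le _ h0 h1).trans (le_of_eq (tsum_congr fun h => ?_))
  split_ifs with hd
  · have hfac : ∀ j m, 0 ≤ supportFactor u bernCoeff j m := by
      intro j m
      unfold supportFactor
      split_ifs
      · exact bernCoeff_nonneg _
      · exact zero_le_one
      · exact le_rfl
    rw [ENNReal.ofReal_prod_of_nonneg fun j _ => hfac j _,
      ← ENNReal.prod_rpow_of_nonneg h0.le]
    refine Finset.prod_congr rfl fun j _ => ?_
    unfold supportFactor
    split_ifs
    · rw [ENNReal.ofReal_rpow_of_nonneg (bernCoeff_nonneg _) h0.le, bernPow]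
    · simp
    · simp [h0]
  · simp [h0]

/-- Separate the frequency in coordinate `d` from the others. With the others fixed, summing over
`w` counts solutions of a linear congruence, and this costs nothing by `tsum_bernPow_mul_card_le`.
-/
lemma sum_cbcCandidates_tsum_le {n : ℕ} (hn : 0 < n) {lam : ℝ} (hlam : 1 / 2 < lam)
    {u : Finset (Fin s)} {d : Fin s} (hd : d ∈ u) (z : Fin s → ℕ) :
    ∑ w ∈ cbcCandidates n, ∑' h : Fin s → ℤ,
      (if (n : ℤ) ∣ freqDot h (Function.update z d w) then
        ∏ j, supportFactor u (bernPow lam) j (h j) else 0) ≤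
      (∑' m : ℤ, bernPow lam m) ^ u.card := by
  have hpow : ∑' h : Fin s → ℤ, ∏ j, supportFactor u (bernPow lam) j (h j) =
      (∑' m : ℤ, bernPow lam m) ^ u.card := by
    rw [ennreal_tsum_prod, ← Finset.prod_const, ← Finset.prod_subset (Finset.subset_univ u)]
    · exact Finset.prod_congr rfl fun j hj => by simp only [supportFactor, if_pos hj]
    · intro j _ hj
      simp [supportFactor, hj]
  rw [← hpow, ← Summable.tsum_finsetSum fun _ _ => ENNReal.summable]
  let e := (Equiv.funSplitAt d ℤ).symm
  have hed : ∀ x, e x d = x.1 := fun x => by simp [e]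
  have hej : ∀ x (j : {j // j ≠ d}), e x j = x.2 j := fun x j => by simp [e, j.2]
  let P : ({j // j ≠ d} → ℤ) → ENNReal := fun h' =>
    ∏ j : {j // j ≠ d}, supportFactor u (bernPow lam) j (h' j)
  let a : ({j // j ≠ d} → ℤ) → ℤ := fun h' => ∑ j : {j // j ≠ d}, h' j * (z j : ℤ)
  have hprod : ∀ x, ∏ j, supportFactor u (bernPow lam) j (e x j) = bernPow lam x.1 * P x.2 := by
    intro x
    rw [Fintype.prod_eq_mul_prod_subtype_ne _ d, hed]
    simp only [hej, P]
    simp only [supportFactor, if_pos hd]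
  have hdot : ∀ x w, freqDot (e x) (Function.update z d w) = x.1 * w + a x.2 := by
    intro x w
    rw [freqDot, Fintype.sum_eq_add_sum_subtype_ne _ d, hed, Function.update_self]
    congr 1
    refine Finset.sum_congr rfl fun j _ => ?_
    rw [hej, Function.update_of_ne j.2]
  have hcount : ∀ x, (∑ w ∈ cbcCandidates n, if (n : ℤ) ∣ freqDot (e x) (Function.update z d w) then
      ∏ j, supportFactor u (bernPow lam) j (e x j) else 0) =
      P x.2 * (bernPow lam x.1 * (congruenceSolutions n x.1 (a x.2)).card) := by
    intro x
    simp only [hdot, hprod]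
    rw [← Finset.sum_filter, Finset.sum_const, nsmul_eq_mul, ← congruenceSolutions]
    ring
  rw [← e.tsum_eq, ← e.tsum_eq (fun h : Fin s → ℤ => ∏ j, supportFactor u (bernPow lam) j (h j))]
  simp only [hcount]
  simp only [hprod]
  rw [ENNReal.tsum_prod', ENNReal.tsum_prod', ENNReal.tsum_comm,
    ENNReal.tsum_comm (f := fun m h' => bernPow lam m * P h')]
  refine ENNReal.tsum_le_tsum fun h' => ?_
  simp only
  rw [ENNReal.tsum_mul_left, ENNReal.tsum_mul_right, mul_comm (∑' m, bernPow lam m)]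
  exact mul_le_mul' le_rfl (tsum_bernPow_mul_card_le hn hlam _)

/-- The sum of the powers of the Fourier coefficients of the Bernoulli polynomial. -/
noncomputable def bernPowSum (lam : ℝ) : ℝ := ∑' m : ℤ, bernCoeff m ^ lam

lemma bernPowSum_nonneg (lam : ℝ) : 0 ≤ bernPowSum lam :=
  tsum_nonneg fun _ => Real.rpow_nonneg (bernCoeff_nonneg _) _

lemma sum_latticeBernAvg_rpow_le {n : ℕ} (hn : 0 < n) {lam : ℝ} (hlam : 1 / 2 < lam)
    (h1 : lam ≤ 1) {u : Finset (Fin s)} {d : Fin s} (hd : d ∈ u) (z : Fin s → ℕ) :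
    ∑ w ∈ cbcCandidates n, latticeBernAvg n u (Function.update z d w) ^ lam ≤
      bernPowSum lam ^ u.card := by
  have h0 : 0 < lam := by linarith
  have hnn : ∀ w, 0 ≤ latticeBernAvg n u (Function.update z d w) ^ lam := fun w =>
    Real.rpow_nonneg (latticeBernAvg_nonneg hn _ _) _
  rw [← ENNReal.ofReal_le_ofReal_iff (pow_nonneg (bernPowSum_nonneg lam) _),
    ENNReal.ofReal_sum_of_nonneg fun w _ => hnn w, ENNReal.ofReal_pow (bernPowSum_nonneg lam),
    bernPowSum, ENNReal.ofReal_tsum_of_nonneg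
      (fun m => Real.rpow_nonneg (bernCoeff_nonneg m) lam) (summable_bernCoeff_rpow hlam)]
  exact (Finset.sum_le_sum fun w _ => ofReal_latticeBernAvg_rpow_le hn u _ h0 h1).trans
    (sum_cbcCandidates_tsum_le hn hlam hd z)

end Averaging

/-! ### The component-by-component algorithm -/

section CBC

variable {s : ℕ}

/-- The subsets of coordinates with largest element `d`. -/
def topSubsets (d : Fin s) : Finset (Finset (Fin s)) := (Finset.Iic d).powerset.filter (d ∈ ·)

lemma mem_topSubsets {d : Fin s} {u : Finset (Fin s)} :
    u ∈ topSubsets d ↔ u ⊆ Finset.Iic d ∧ d ∈ u := by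
  rw [topSubsets, Finset.mem_filter, Finset.mem_powerset]

lemma sum_topSubsets (F : Finset (Fin s) → ℝ) :
    ∑ d, ∑ u ∈ topSubsets d, F u = ∑ u ∈ Finset.univ.erase ∅, F u := by
  rw [← Finset.sum_biUnion]
  · refine Finset.sum_congr ?_ fun _ _ => rfl
    ext u
    simp only [Finset.mem_biUnion, Finset.mem_univ, true_and, Finset.mem_erase, and_true,
      mem_topSubsets]
    constructor
    · rintro ⟨d, -, hd⟩ rfl
      simp at hd
    · intro hu
      have hne : u.Nonempty := Finset.nonempty_iff_ne_empty.2 hu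
      exact ⟨u.max' hne, fun j hj => Finset.mem_Iic.2 (u.le_max' j hj), u.max'_mem hne⟩
  · intro d _ d' _ hne
    rw [Function.onFun, Finset.disjoint_left]
    intro u hu hu'
    rw [mem_topSubsets] at hu hu'
    exact hne (le_antisymm (Finset.mem_Iic.1 (hu'.1 hu.2)) (Finset.mem_Iic.1 (hu.1 hu'.2)))

lemma shiftAvgErrorSq_eq (n : ℕ) (γ : Finset (Fin s) → ℝ) (d : Fin s) (z : Fin s → ℕ) :
    shiftAvgErrorSq n γ d z = ∑ u ∈ (Finset.Iic d).powerset.erase ∅, γ u * latticeBernAvg n u z :=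
  rfl

lemma latticeBernAvg_congr (n : ℕ) {u : Finset (Fin s)} {z z' : Fin s → ℕ}
    (h : ∀ j ∈ u, z j = z' j) : latticeBernAvg n u z = latticeBernAvg n u z' := by
  rw [latticeBernAvg, latticeBernAvg]
  congr 1
  refine Finset.sum_congr rfl fun i _ => Finset.prod_congr rfl fun j hj => ?_
  rw [latticePoint, latticePoint, h j hj]

lemma shiftAvgErrorSq_congr (n : ℕ) (γ : Finset (Fin s) → ℝ) (d : Fin s) {z z' : Fin s → ℕ}
    (h : ∀ j ≤ d, z j = z' j) : shiftAvgErrorSq n γ d z = shiftAvgErrorSq n γ d z' := by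
  rw [shiftAvgErrorSq_eq, shiftAvgErrorSq_eq]
  refine Finset.sum_congr rfl fun u hu => ?_
  rw [latticeBernAvg_congr n fun j hj => h j (Finset.mem_Iic.1
    (Finset.mem_powerset.1 (Finset.mem_of_mem_erase hu) hj))]

/-- Subsets without `d` do not see the change, so minimising the whole criterion minimises the part
indexed by `topSubsets d`. -/
lemma shiftAvgErrorSq_update_sub (n : ℕ) (γ : Finset (Fin s) → ℝ) (d : Fin s) (z : Fin s → ℕ)
    (w : ℕ) : shiftAvgErrorSq n γ d (Function.update z d w) - shiftAvgErrorSq n γ d z =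
      ∑ u ∈ topSubsets d, γ u * latticeBernAvg n u (Function.update z d w) -
        ∑ u ∈ topSubsets d, γ u * latticeBernAvg n u z := by
  rw [shiftAvgErrorSq_eq, shiftAvgErrorSq_eq, ← Finset.sum_sub_distrib, ← Finset.sum_sub_distrib]
  symm
  refine Finset.sum_subset ?_ ?_
  · intro u hu
    rw [mem_topSubsets] at hu
    rw [Finset.mem_erase, Finset.mem_powerset]
    exact ⟨Finset.nonempty_iff_ne_empty.1 ⟨d, hu.2⟩, hu.1⟩
  · intro u hu hu'
    rw [Finset.mem_erase, Finset.mem_powerset] at hu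
    have hd : d ∉ u := fun hd => hu' (mem_topSubsets.2 ⟨hu.2, hd⟩)
    rw [latticeBernAvg_congr n (z := Function.update z d w) (z' := z), sub_self]
    intro j hj
    exact Function.update_of_ne (fun h : j = d => hd (h ▸ hj)) _ _

lemma one_mem_cbcCandidates {n : ℕ} (hn : 0 < n) : 1 ∈ cbcCandidates n := by
  rw [cbcCandidates, Finset.mem_filter, Finset.mem_Icc]
  exact ⟨⟨le_rfl, hn⟩, Nat.coprime_one_left n⟩

/-- The component-by-component algorithm yields a generating vector. -/
lemma exists_isCBCOutput {n : ℕ} (hn : 0 < n) (γ : Finset (Fin s) → ℝ) :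
    ∃ z : Fin s → ℕ, IsCBCOutput n γ z := by
  -- Induction on the number of fixed components; entries from `t` on are placeholders. Criteria for
  -- earlier components ignore later entries, so earlier choices remain optimal.
  have key : ∀ t ≤ s, ∃ z : Fin s → ℕ, ∀ d : Fin s, (d : ℕ) < t → z d ∈ cbcCandidates n ∧
      ∀ w ∈ cbcCandidates n,
        shiftAvgErrorSq n γ d z ≤ shiftAvgErrorSq n γ d (Function.update z d w) := by
    intro t
    induction t with
    | zero => exact fun _ => ⟨0, fun d hd => absurd hd (Nat.not_lt_zero _)⟩
    | succ t ih =>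
      intro ht
      obtain ⟨z, hz⟩ := ih (by omega)
      let d₀ : Fin s := ⟨t, ht⟩
      obtain ⟨v, hv, hmin⟩ := Finset.exists_min_image (cbcCandidates n)
        (fun w => shiftAvgErrorSq n γ d₀ (Function.update z d₀ w)) ⟨1, one_mem_cbcCandidates hn⟩
      refine ⟨Function.update z d₀ v, fun d hd => ?_⟩
      rcases Nat.lt_succ_iff_lt_or_eq.1 hd with hlt | heq
      · have hne : ∀ j ≤ d, j ≠ d₀ := by
          rintro j hj rfl
          exact absurd (Fin.le_def.1 hj) (by simpa [d₀] using hlt)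
        obtain ⟨h1, h2⟩ := hz d hlt
        rw [Function.update_of_ne (hne d le_rfl)]
        refine ⟨h1, fun w hw => ?_⟩
        rw [shiftAvgErrorSq_congr n γ d (z := Function.update z d₀ v) (z' := z)
            fun j hj => Function.update_of_ne (hne j hj) _ _,
          Function.update_comm (hne d le_rfl).symm,
          shiftAvgErrorSq_congr n γ d (z := Function.update (Function.update z d w) d₀ v)
            (z' := Function.update z d w)
            fun j hj => Function.update_of_ne (hne j hj) _ _]
        exact h2 w hw
      · obtain rfl : d = d₀ := Fin.ext heq
        rw [Function.update_self]
        refine ⟨hv, fun w hw => ?_⟩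
        rw [Function.update_idem]
        exact hmin w hw
  obtain ⟨z, hz⟩ := key s le_rfl
  exact ⟨z, fun d => hz d d.2⟩

/-- The error bound for generating vectors constructed component by component. -/
lemma IsCBCOutput.card_mul_rpow_le {n : ℕ} (hn : 0 < n) {γ : Finset (Fin s) → ℝ}
    (hγ : ∀ u, 0 ≤ γ u) {z : Fin s → ℕ} (hz : IsCBCOutput n γ z) {lam : ℝ} (hlam : 1 / 2 < lam)
    (h1 : lam ≤ 1) :
    (cbcCandidates n).card * (∑ u ∈ Finset.univ.erase ∅, γ u * latticeBernAvg n u z) ^ lam ≤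
      ∑ u ∈ Finset.univ.erase ∅, γ u ^ lam * bernPowSum lam ^ u.card := by
  have h0 : 0 < lam := by linarith
  have hnn : ∀ u z, 0 ≤ γ u * latticeBernAvg n u z := fun u z =>
    mul_nonneg (hγ u) (latticeBernAvg_nonneg hn u z)
  -- The minimum over candidates, counted once per candidate, is at most the sum over candidates;
  -- subadditivity of the power then separates the subsets.
  have hstep : ∀ d, (cbcCandidates n).card *
      (∑ u ∈ topSubsets d, γ u * latticeBernAvg n u z) ^ lam ≤
      ∑ u ∈ topSubsets d, γ u ^ lam * bernPowSum lam ^ u.card := by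
    intro d
    calc (cbcCandidates n).card * (∑ u ∈ topSubsets d, γ u * latticeBernAvg n u z) ^ lam
        = ∑ w ∈ cbcCandidates n, (∑ u ∈ topSubsets d, γ u * latticeBernAvg n u z) ^ lam := by
          rw [Finset.sum_const, nsmul_eq_mul]
      _ ≤ ∑ w ∈ cbcCandidates n, ∑ u ∈ topSubsets d,
            γ u ^ lam * latticeBernAvg n u (Function.update z d w) ^ lam := by
          refine Finset.sum_le_sum fun w hw => ?_
          have hmin := (hz d).2 w hw
          have hdiff := shiftAvgErrorSq_update_sub n γ d z w
          have hle : ∑ u ∈ topSubsets d, γ u * latticeBernAvg n u z ≤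
              ∑ u ∈ topSubsets d, γ u * latticeBernAvg n u (Function.update z d w) := by
            linarith
          refine (Real.rpow_le_rpow (Finset.sum_nonneg fun u _ => hnn u z) hle h0.le).trans ?_
          refine (real_rpow_sum_le _ (fun u _ => hnn u _) h0 h1).trans (le_of_eq ?_)
          exact Finset.sum_congr rfl fun u _ =>
            Real.mul_rpow (hγ u) (latticeBernAvg_nonneg hn u _)
      _ = ∑ u ∈ topSubsets d, γ u ^ lam *
            ∑ w ∈ cbcCandidates n, latticeBernAvg n u (Function.update z d w) ^ lam := by
          rw [Finset.sum_comm]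
          simp only [Finset.mul_sum]
      _ ≤ ∑ u ∈ topSubsets d, γ u ^ lam * bernPowSum lam ^ u.card := by
          refine Finset.sum_le_sum fun u hu => ?_
          have := Real.rpow_nonneg (hγ u) lam
          have := sum_latticeBernAvg_rpow_le hn hlam h1 (mem_topSubsets.1 hu).2 z
          gcongr
  rw [← sum_topSubsets, ← sum_topSubsets]
  calc (cbcCandidates n).card * (∑ d, ∑ u ∈ topSubsets d, γ u * latticeBernAvg n u z) ^ lam
      ≤ (cbcCandidates n).card * ∑ d, (∑ u ∈ topSubsets d, γ u * latticeBernAvg n u z) ^ lam := by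
        gcongr
        exact real_rpow_sum_le _ (fun d _ => Finset.sum_nonneg fun u _ => hnn u z) h0 h1
    _ = ∑ d, (cbcCandidates n).card * (∑ u ∈ topSubsets d, γ u * latticeBernAvg n u z) ^ lam := by
        rw [Finset.mul_sum]
    _ ≤ _ := Finset.sum_le_sum fun d _ => hstep d

/-- Half of the residues are odd. For `m = 0` the only candidate is `1`. -/
lemma two_pow_le_two_mul_card_cbcCandidates (m : ℕ) :
    2 ^ m ≤ 2 * (cbcCandidates (2 ^ m)).card := by
  rcases m with _ | m
  · decide
  · have h : (Finset.range (2 ^ m)).image (fun k => 2 * k + 1) ⊆ cbcCandidates (2 ^ (m + 1)) := by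
      intro w hw
      rw [Finset.mem_image] at hw
      obtain ⟨k, hk, rfl⟩ := hw
      rw [Finset.mem_range] at hk
      rw [cbcCandidates, Finset.mem_filter, Finset.mem_Icc]
      refine ⟨⟨by omega, by rw [pow_succ]; omega⟩, Nat.Coprime.pow_right _ ?_⟩
      exact Nat.coprime_two_right.2 ⟨k, rfl⟩
    have hc := Finset.card_le_card h
    rw [Finset.card_image_of_injective _ fun a b hab => by simpa using hab,
      Finset.card_range] at hc
    have := pow_succ 2 m
    omega

end CBC

/-! ### Dimension-independent sums of Gevrey terms -/

section WeightSums

/-- The first two terms of the binomial expansion; this drives the induction for elementary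
symmetric functions. -/
lemma add_pow_ge_of_nonneg {S x : ℝ} (hS : 0 ≤ S) (hx : 0 ≤ x) (m : ℕ) :
    S ^ (m + 1) + (m + 1) * (x * S ^ m) ≤ (S + x) ^ (m + 1) := by
  induction m with
  | zero => simp
  | succ m ih =>
    calc S ^ (m + 1 + 1) + ((m + 1 : ℕ) + 1) * (x * S ^ (m + 1))
        ≤ (S ^ (m + 1) + (m + 1) * (x * S ^ m)) * (S + x) := by
          have : 0 ≤ (m + 1) * (x ^ 2 * S ^ m) := by positivity
          push_cast
          linear_combination this
      _ ≤ (S + x) ^ (m + 1) * (S + x) := by gcongr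
      _ = _ := by rw [← pow_succ]

/-- Elementary symmetric functions are bounded by divided powers of the sum. -/
lemma sum_powersetCard_prod_mul_factorial_le {ι : Type*} [DecidableEq ι] {x : ι → ℝ}
    (hx : ∀ i, 0 ≤ x i) (t : Finset ι) :
    ∀ m : ℕ, (∑ u ∈ t.powersetCard m, ∏ i ∈ u, x i) * m.factorial ≤ (∑ i ∈ t, x i) ^ m := by
  induction t using Finset.induction_on with
  | empty =>
    intro m
    rcases m with _ | m
    · simp
    · rw [Finset.powersetCard_eq_empty.2 (by simp)]
      simp
  | insert a t ha ih =>
    intro m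
    rcases m with _ | m
    · simp
    · have hS : 0 ≤ ∑ i ∈ t, x i := Finset.sum_nonneg fun i _ => hx i
      have hsplit : ∑ u ∈ (insert a t).powersetCard (m + 1), ∏ i ∈ u, x i =
          (∑ u ∈ t.powersetCard (m + 1), ∏ i ∈ u, x i) +
            x a * ∑ u ∈ t.powersetCard m, ∏ i ∈ u, x i := by
        have hmem : ∀ k, ∀ u ∈ t.powersetCard k, a ∉ u := fun k u hu h =>
          ha ((Finset.mem_powersetCard.1 hu).1 h)
        rw [Finset.powersetCard_succ_insert ha, Finset.sum_union, Finset.sum_image,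
          Finset.mul_sum]
        · congr 1
          exact Finset.sum_congr rfl fun u hu => Finset.prod_insert (hmem m u hu)
        · intro u hu v hv huv
          rw [← Finset.erase_insert (hmem m u hu), huv, Finset.erase_insert (hmem m v hv)]
        · rw [Finset.disjoint_left]
          intro u hu hu'
          obtain ⟨v, -, rfl⟩ := Finset.mem_image.1 hu'
          exact hmem _ _ hu (Finset.mem_insert_self a v)
      rw [hsplit, Finset.sum_insert ha, add_comm (x a)]
      refine le_trans ?_ (add_pow_ge_of_nonneg hS (hx a) m)
      have h1 := ih (m + 1)
      have h2 := mul_le_mul_of_nonneg_left (ih m)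
        (mul_nonneg (by positivity : (0 : ℝ) ≤ m + 1) (hx a))
      rw [add_mul]
      refine add_le_add h1 (le_trans (le_of_eq ?_) (h2.trans (le_of_eq ?_)))
      · rw [Nat.factorial_succ]; push_cast; ring
      · ring

/-- Geometric decay beats the powers of factorials of negative order. -/
lemma exists_pow_div_factorial_rpow_le {A ε : ℝ} (hA : 0 ≤ A) (hε : 0 < ε) :
    ∃ B : ℝ, ∀ m : ℕ, A ^ m * (m.factorial : ℝ) ^ (-ε) ≤ B * (1 / 2) ^ m := by
  -- From `x^m / m! ≤ exp x` at `x = (2A)^(1/ε)`, raised to the power `ε`; the extra `2` leaves the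
  -- factor `(1/2)^m`.
  refine ⟨Real.exp ((2 * A) ^ (1 / ε)) ^ ε, fun m => ?_⟩
  have h1 := Real.rpow_le_rpow (by positivity)
    (Real.pow_div_factorial_le_exp ((2 * A) ^ (1 / ε)) (by positivity) m) hε.le
  have h2 : (((2 * A) ^ (1 / ε)) ^ m / m.factorial : ℝ) ^ ε =
      (2 * A) ^ m * (m.factorial : ℝ) ^ (-ε) := by
    rw [Real.div_rpow (by positivity) (by positivity), Real.rpow_neg (by positivity),
      ← Real.rpow_natCast, ← Real.rpow_mul (by positivity), ← Real.rpow_mul (by positivity),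
      div_eq_mul_inv]
    congr 1
    rw [← Real.rpow_natCast]
    congr 1
    field_simp
  rw [h2, mul_pow] at h1
  calc A ^ m * (m.factorial : ℝ) ^ (-ε)
      = (2 ^ m * A ^ m * (m.factorial : ℝ) ^ (-ε)) * (1 / 2) ^ m := by
        have : (2 : ℝ) ^ m * (1 / 2) ^ m = 1 := by rw [← mul_pow]; norm_num
        linear_combination (-(A ^ m * (m.factorial : ℝ) ^ (-ε))) * this
    _ ≤ _ := by gcongr

/-- The Gevrey sequence `(|u|!)^β ∏_{j ∈ u} κ b_j`. -/
noncomputable def gevreyTerm (β : ℝ) (b : ℕ → ℝ) (κ : ℝ) {s : ℕ} (u : Finset (Fin s)) : ℝ :=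
  (u.card.factorial : ℝ) ^ β * κ ^ u.card * ∏ j ∈ u, b j

variable {β p : ℝ} {b : ℕ → ℝ} {s : ℕ}

lemma gevreyTerm_nonneg (hb : ∀ j, 0 ≤ b j) {κ : ℝ} (hκ : 0 ≤ κ) (u : Finset (Fin s)) :
    0 ≤ gevreyTerm β b κ u := by
  have : 0 ≤ ∏ j ∈ u, b j := Finset.prod_nonneg fun j _ => hb j
  unfold gevreyTerm
  positivity

lemma gevreyTerm_mul (a κ : ℝ) (u : Finset (Fin s)) :
    gevreyTerm β b (a * κ) u = a ^ u.card * gevreyTerm β b κ u := by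
  rw [gevreyTerm, gevreyTerm, mul_pow]
  ring

/-- Geometric factors in `|u|` merely change `κ`, so they never affect summability. -/
lemma pow_mul_gevreyTerm_rpow (hb : ∀ j, 0 ≤ b j) {κ a q : ℝ} (hκ : 0 ≤ κ) (ha : 0 ≤ a)
    (hq : 0 < q) (u : Finset (Fin s)) :
    a ^ u.card * gevreyTerm β b κ u ^ q = gevreyTerm β b (a ^ (1 / q) * κ) u ^ q := by
  rw [gevreyTerm_mul, Real.mul_rpow (by positivity) (gevreyTerm_nonneg hb hκ u)]
  congr 1
  rw [← Real.rpow_natCast, ← Real.rpow_natCast, ← Real.rpow_mul ha, ← Real.rpow_mul ha]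
  congr 1
  field_simp

/-- Grouping by `m = |u|`, the elementary symmetric function of `(κ b_j)^p` supplies `1 / m!`, which
outweighs `(m!)^(βp)`. The residual negative power of `m!` beats any geometric growth. -/
lemma exists_sum_gevreyTerm_rpow_le (hβp : β * p < 1) (hb : ∀ j, 0 ≤ b j)
    (hsum : Summable fun j => b j ^ p) {κ : ℝ} (hκ : 0 ≤ κ) :
    ∃ T : ℝ, ∀ s : ℕ, ∑ u : Finset (Fin s), gevreyTerm β b κ u ^ p ≤ T := by
  let x : ℕ → ℝ := fun j => (κ * b j) ^ p
  have hx : ∀ j, 0 ≤ x j := fun j => Real.rpow_nonneg (mul_nonneg hκ (hb j)) _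
  have hxs : Summable x := by
    refine (hsum.mul_left (κ ^ p)).congr fun j => ?_
    rw [← Real.mul_rpow hκ (hb j)]
  set A := ∑' j, x j with hA
  have hAnn : 0 ≤ A := tsum_nonneg hx
  obtain ⟨B, hB⟩ := exists_pow_div_factorial_rpow_le hAnn (by linarith : 0 < 1 - β * p)
  have hBnn : 0 ≤ B := by simpa using (le_trans (by simp) (hB 0) : (0 : ℝ) ≤ B * (1 / 2) ^ 0)
  refine ⟨B * 2, fun s => ?_⟩
  have hterm : ∀ u : Finset (Fin s), gevreyTerm β b κ u ^ p =
      (u.card.factorial : ℝ) ^ (β * p) * ∏ j ∈ u, x j := by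
    intro u
    have hnn : ∀ j : Fin s, 0 ≤ κ * b j := fun j => mul_nonneg hκ (hb j)
    have hprod : κ ^ u.card * ∏ j ∈ u, b j = ∏ j ∈ u, κ * b j := by
      rw [Finset.prod_mul_distrib, Finset.prod_const]
    rw [gevreyTerm, mul_assoc, hprod, Real.mul_rpow (by positivity)
      (Finset.prod_nonneg fun j _ => hnn j), ← Real.rpow_mul (by positivity),
      ← Real.finsetProd_rpow _ _ fun j _ => hnn j]
  have hSA : ∑ j : Fin s, x j ≤ A := by
    rw [Fin.sum_univ_eq_sum_range]
    exact hxs.sum_le_tsum _ fun j _ => hx j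
  have hSnn : 0 ≤ ∑ j : Fin s, x j := Finset.sum_nonneg fun j _ => hx j
  calc ∑ u : Finset (Fin s), gevreyTerm β b κ u ^ p
      = ∑ m ∈ Finset.range (s + 1), ∑ u ∈ (Finset.univ : Finset (Fin s)).powersetCard m,
          (u.card.factorial : ℝ) ^ (β * p) * ∏ j ∈ u, x j := by
        rw [← Finset.powerset_univ, Finset.sum_congr rfl fun u _ => hterm u, Finset.sum_powerset]
        simp
    _ = ∑ m ∈ Finset.range (s + 1), (m.factorial : ℝ) ^ (β * p) *
          ∑ u ∈ (Finset.univ : Finset (Fin s)).powersetCard m, ∏ j ∈ u, x j := by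
        refine Finset.sum_congr rfl fun m _ => ?_
        rw [Finset.mul_sum]
        refine Finset.sum_congr rfl fun u hu => ?_
        rw [(Finset.mem_powersetCard.1 hu).2]
    _ ≤ ∑ m ∈ Finset.range (s + 1), B * (1 / 2) ^ m := by
        refine Finset.sum_le_sum fun m _ => ?_
        refine le_trans ?_ (hB m)
        have hf : (0 : ℝ) < m.factorial := by exact_mod_cast m.factorial_pos
        have h1 := sum_powersetCard_prod_mul_factorial_le (fun j : Fin s => hx j) Finset.univ m
        rw [← le_div_iff₀ hf] at h1
        calc (m.factorial : ℝ) ^ (β * p) *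
              ∑ u ∈ (Finset.univ : Finset (Fin s)).powersetCard m, ∏ j ∈ u, x j
            ≤ (m.factorial : ℝ) ^ (β * p) * (A ^ m / m.factorial) := by
              gcongr
              exact h1.trans (by gcongr)
          _ = A ^ m * (m.factorial : ℝ) ^ (-(1 - β * p)) := by
              rw [neg_sub, Real.rpow_sub_one hf.ne']
              ring
    _ ≤ B * 2 := by
        rw [← Finset.mul_sum]
        gcongr
        have := (summable_geometric_of_lt_one (r := (1 / 2 : ℝ)) (by norm_num)
          (by norm_num)).sum_le_tsum (Finset.range (s + 1)) (fun _ _ => by positivity)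
        rwa [tsum_geometric_two] at this

/-- The inclusion of `ℓ^p` in `ℓ^q`, obtained from subadditivity with exponent `p / q ≤ 1`. -/
lemma exists_sum_gevreyTerm_rpow_le_of_le (hp : 0 < p) (hβp : β * p < 1) (hb : ∀ j, 0 ≤ b j)
    (hsum : Summable fun j => b j ^ p) {κ q : ℝ} (hκ : 0 ≤ κ) (hpq : p ≤ q) :
    ∃ T : ℝ, 0 ≤ T ∧ ∀ s : ℕ, ∑ u : Finset (Fin s), gevreyTerm β b κ u ^ q ≤ T := by
  obtain ⟨T, hT⟩ := exists_sum_gevreyTerm_rpow_le hβp hb hsum hκ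
  have hq : 0 < q := hp.trans_le hpq
  have hTnn : 0 ≤ T := le_trans (Finset.sum_nonneg fun u _ =>
    Real.rpow_nonneg (gevreyTerm_nonneg hb hκ u) _) (hT 0)
  refine ⟨T ^ (q / p), by positivity, fun s => ?_⟩
  have hnn : ∀ u : Finset (Fin s), 0 ≤ gevreyTerm β b κ u ^ q := fun u =>
    Real.rpow_nonneg (gevreyTerm_nonneg hb hκ u) _
  have h1 := real_rpow_sum_le (Finset.univ : Finset (Finset (Fin s))) (fun u _ => hnn u)
    (lam := p / q) (by positivity) ((div_le_one hq).2 hpq)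
  have h2 : ∀ u : Finset (Fin s), (gevreyTerm β b κ u ^ q) ^ (p / q) =
      gevreyTerm β b κ u ^ p := by
    intro u
    rw [← Real.rpow_mul (gevreyTerm_nonneg hb hκ u)]
    congr 1
    field_simp
  simp only [h2] at h1
  have h3 := Real.rpow_le_rpow (Real.rpow_nonneg (Finset.sum_nonneg fun u _ => hnn u) _)
    (h1.trans (hT s)) (by positivity : 0 ≤ q / p)
  rwa [← Real.rpow_mul (Finset.sum_nonneg fun u _ => hnn u), div_mul_div_cancel₀ hq.ne',
    div_self hp.ne', Real.rpow_one] at h3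

end WeightSums

/-! ### The exponent and the constants in the weights -/

section Parameters

lemma weightExponent_gt {p δ : ℝ} (hδ : 0 < δ) (hδ' : δ < 1 / 2) (hp1 : p < 1) :
    1 / 2 < weightExponent p δ := by
  unfold weightExponent
  split_ifs with h
  · rw [lt_div_iff₀ (by linarith)]; linarith
  · rw [lt_div_iff₀ (by linarith)]; linarith

lemma weightExponent_lt {p δ : ℝ} (hδ' : δ < 1 / 2) (hp1 : p < 1) :
    weightExponent p δ < 1 := by
  unfold weightExponent
  split_ifs with h
  · rw [div_lt_one (by linarith)]; linarith
  · rw [div_lt_one (by linarith)]; linarith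

/-- The claim amounts to `p / (2 - p) ≤ λ`: an equality when `p > 2/3`, while otherwise the left
side is at most `1/2`. -/
lemma le_two_mul_weightExponent_div {p δ : ℝ} (hδ : 0 < δ) (hδ' : δ < 1 / 2) (hp1 : p < 1) :
    p ≤ 2 * weightExponent p δ / (1 + weightExponent p δ) := by
  have h1 := weightExponent_gt hδ hδ' hp1
  rw [le_div_iff₀ (by linarith)]
  by_cases h : 2 / 3 < p
  · have : weightExponent p δ * (2 - p) = p := by
      rw [weightExponent, if_pos h]
      exact div_mul_cancel₀ _ (by linarith)
    linarith
  · nlinarith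

lemma neg_inv_weightExponent_le {p δ : ℝ} (hp : 0 < p) (hδ' : δ < 1 / 2) :
    -(1 / (2 * weightExponent p δ)) ≤ max (-1 / p + 1 / 2) (-1 + δ) := by
  unfold weightExponent
  split_ifs with h
  · refine le_max_of_le_left (le_of_eq ?_)
    -- No upper bound on `p` is assumed; at `p = 2` the default value of division by zero makes both
    -- sides vanish.
    by_cases h2 : 2 - p = 0
    · rw [h2, div_zero, mul_zero, div_zero]
      have : p = 2 := by linarith
      subst this
      norm_num
    · field_simp
      ring
  · refine le_max_of_le_right (le_of_eq ?_)
    have : (2 - 2 * δ) ≠ 0 := by linarith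
    field_simp
    ring

lemma rho_pos {lam : ℝ} (hlam : 1 / 2 < lam) : 0 < rho lam := by
  have hs : Summable fun l : ℕ => ((l : ℝ) + 1) ^ (-(2 * lam)) := by
    have h := (summable_nat_add_iff 1).2
      (Real.summable_nat_rpow.2 (by linarith : -(2 * lam) < -1))
    simpa using h
  have hz : 0 < zetaSum (2 * lam) := by
    refine hs.tsum_pos (fun l => by positivity) 0 (by simp)
  unfold rho
  positivity

/-- The constant in the weights. -/
noncomputable def podConst (C β μmin lam : ℝ) : ℝ :=
  (2 : ℝ) ^ β * C / Real.sqrt μmin / Real.sqrt (rho lam)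

lemma podConst_pos {C β μmin lam : ℝ} (hC : 0 < C) (hμ : 0 < μmin) (hlam : 1 / 2 < lam) :
    0 < podConst C β μmin lam := by
  have := rho_pos hlam
  unfold podConst
  positivity

lemma podWeight_eq (C β μmin lam : ℝ) (b : ℕ → ℝ) {s : ℕ} (u : Finset (Fin s)) :
    podWeight C β μmin lam b u =
      gevreyTerm β b (podConst C β μmin lam) u ^ (2 / (1 + lam)) := by
  rw [podWeight, gevreyTerm]
  congr 1
  rw [mul_assoc]
  congr 1
  rw [← Finset.prod_const, ← Finset.prod_mul_distrib]
  refine Finset.prod_congr rfl fun j _ => ?_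
  rw [podFactor, podConst]
  ring

end Parameters

/-! ### Matching derivatives with weights -/

section Assembly

variable {s : ℕ}

/-- The squared error functional with all coordinates, as a sum over the dual lattice. -/
lemma hasSum_weighted {n : ℕ} (hn : 0 < n) (γ : Finset (Fin s) → ℝ) (S₀ : ℝ) (z : Fin s → ℕ) :
    HasSum (fun h : Fin s → ℤ => ∑ u ∈ Finset.univ.erase ∅, S₀ * γ u *
      (if (n : ℤ) ∣ freqDot h z then ∏ j, supportFactor u bernCoeff j (h j) else 0))
      (S₀ * ∑ u ∈ Finset.univ.erase ∅, γ u * latticeBernAvg n u z) := by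
  have h := hasSum_sum (s := (Finset.univ : Finset (Finset (Fin s))).erase ∅) fun u _ =>
    (hasSum_latticeBernAvg hn u z).mul_left (S₀ * γ u)
  convert! h using 1
  rw [Finset.mul_sum]
  exact Finset.sum_congr rfl fun u _ => by ring

/-- The constant `π² / 2` is the ratio of `1 / (4 h²)`, from the Fourier decay, to the kernel
coefficient `1 / (2π² h²)`. -/
lemma sq_prod_eq (h : Fin s → ℤ) :
    (∏ j ∈ freqSupport h, 1 / (2 * |(h j : ℝ)|)) ^ 2 =
      (Real.pi ^ 2 / 2) ^ (freqSupport h).card * ∏ j ∈ freqSupport h, bernCoeff (h j) := by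
  rw [← Finset.prod_pow, ← Finset.prod_const, ← Finset.prod_mul_distrib]
  refine Finset.prod_congr rfl fun j hj => ?_
  have h0 : (h j : ℝ) ≠ 0 := by exact_mod_cast mem_freqSupport.1 hj
  have hπ := Real.pi_ne_zero
  rw [bernCoeff, div_pow, mul_pow, sq_abs]
  field_simp

/-- The error bound in terms of the weighted worst-case error. -/
lemma rmsError_le_of_weights {n : ℕ} (hn : 0 < n) (z : Fin s → ℕ) {R : ℕ} (hR : 0 < R)
    {f : (Fin s → ℝ) → ℝ} (hf : ContinuousOn f (paramBox s))
    {E : Finset (Fin s) → (Fin s → ℝ) → ℝ} (hE : IsMixedFamily E)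
    (hEf : ∀ x ∈ paramBox s, E ∅ x = f x)
    {M : Finset (Fin s) → ℝ} (hM : ∀ u, ∀ x ∈ paramBox s, |E u x| ≤ M u)
    {γ : Finset (Fin s) → ℝ} (hγ : ∀ u, 0 ≤ γ u) {S₀ : ℝ} (hS₀ : 0 ≤ S₀)
    (hMγ : ∀ u, M u ^ 2 * (Real.pi ^ 2 / 2) ^ u.card ≤ S₀ * γ u) :
    MemLp (cubatureError n z R f) 2 (shiftLaw s R) ∧ rmsError n z R f ≤
      Real.sqrt (S₀ * ∑ u ∈ Finset.univ.erase ∅, γ u * latticeBernAvg n u z) := by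
  have hnn : ∀ (h : Fin s → ℤ) (u : Finset (Fin s)), 0 ≤ S₀ * γ u *
      (if (n : ℤ) ∣ freqDot h z then ∏ j, supportFactor u bernCoeff j (h j) else 0) := by
    intro h u
    refine mul_nonneg (mul_nonneg hS₀ (hγ u)) ?_
    split_ifs
    · exact prod_supportFactor_nonneg u h
    · exact le_rfl
  refine rmsError_le hn z hR hf hE hEf hM (hasSum_weighted hn γ S₀ z)
    (fun h => Finset.sum_nonneg fun u _ => hnn h u) fun h h0 hd => ?_
  have hmem : freqSupport h ∈ (Finset.univ : Finset (Finset (Fin s))).erase ∅ := by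
    obtain ⟨j, hj⟩ := Function.ne_iff.1 h0
    rw [Finset.mem_erase]
    exact ⟨Finset.nonempty_iff_ne_empty.1 ⟨j, mem_freqSupport.2 hj⟩, Finset.mem_univ _⟩
  -- A frequency contributes only through its own support, so a bound on each ratio of squared
  -- derivative to weight suffices; no sum of ratios is needed.
  refine le_trans ?_ (Finset.single_le_sum (fun u _ => hnn h u) hmem)
  rw [if_pos hd, prod_supportFactor _ bernCoeff_zero, if_pos rfl, mul_pow, sq_prod_eq, ← mul_assoc]
  exact mul_le_mul_of_nonneg_right (hMγ _) (Finset.prod_nonneg fun j _ => bernCoeff_nonneg _)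

/-- The weights dominate the squared mixed derivatives up to a constant independent of the
dimension. -/
lemma exists_gevreyTerm_sq_le_podWeight {C β μmin p lam : ℝ} (hC : 0 < C) (hμ : 0 < μmin)
    (hlam : 1 / 2 < lam) (hp : 0 < p) (hβp : β * p < 1) {b : ℕ → ℝ} (hb : ∀ j, 0 ≤ b j)
    (hsum : Summable fun j => b j ^ p) (hpq : p ≤ 2 * lam / (1 + lam)) (A : ℝ) {κ : ℝ}
    (hκ : 0 ≤ κ) :
    ∃ S₀ : ℝ, 0 ≤ S₀ ∧ ∀ (s : ℕ) (u : Finset (Fin s)),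
      (A * gevreyTerm β b κ u) ^ 2 * (Real.pi ^ 2 / 2) ^ u.card ≤
        S₀ * podWeight C β μmin lam b u := by
  set κ₁ := podConst C β μmin lam with hκ₁
  have hκ₁pos : 0 < κ₁ := podConst_pos hC hμ hlam
  set q := 2 * lam / (1 + lam) with hq
  have hqpos : 0 < q := hp.trans_le hpq
  set r := 2 / (1 + lam) with hr
  have hrnn : 0 ≤ r := div_nonneg (by norm_num) (by linarith)
  -- The square splits as a power `r`, compared with the weight, and a power `q`, which is summable
  -- and hence bounded.
  have hrq : r + q = 2 := by
    rw [hr, hq]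
    have : 1 + lam ≠ 0 := by linarith
    field_simp
  set κ₂ := Real.sqrt (Real.pi ^ 2 / 2) * κ with hκ₂
  have hκ₂nn : 0 ≤ κ₂ := by positivity
  set a := (κ₂ / κ₁) ^ r with ha
  have hann : 0 ≤ a := by positivity
  obtain ⟨T, hTnn, hT⟩ := exists_sum_gevreyTerm_rpow_le_of_le (κ := a ^ (1 / q) * κ₂) hp hβp hb
    hsum (by positivity) hpq
  refine ⟨A ^ 2 * T, by positivity, fun s u => ?_⟩
  have hg2 := gevreyTerm_nonneg (β := β) hb hκ₂nn u
  have hg1 := gevreyTerm_nonneg (β := β) hb hκ₁pos.le u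
  have e1 : (A * gevreyTerm β b κ u) ^ 2 * (Real.pi ^ 2 / 2) ^ u.card =
      A ^ 2 * gevreyTerm β b κ₂ u ^ 2 := by
    rw [hκ₂, gevreyTerm_mul, mul_pow, mul_pow, ← pow_mul, mul_comm u.card, pow_mul,
      Real.sq_sqrt (by positivity)]
    ring
  -- Changing `κ₂` to `κ₁` in the power `r` costs `a^|u|`, which is handed over to the power `q`.
  have e2 : gevreyTerm β b κ₂ u ^ 2 =
      (a ^ u.card * gevreyTerm β b κ₂ u ^ q) * gevreyTerm β b κ₁ u ^ r := by
    have e3 : gevreyTerm β b κ₂ u = (κ₂ / κ₁) ^ u.card * gevreyTerm β b κ₁ u := by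
      rw [← gevreyTerm_mul, div_mul_cancel₀ _ hκ₁pos.ne']
    have e4 : gevreyTerm β b κ₂ u ^ r = a ^ u.card * gevreyTerm β b κ₁ u ^ r := by
      rw [e3, Real.mul_rpow (by positivity) hg1, ha]
      congr 1
      rw [← Real.rpow_natCast, ← Real.rpow_natCast, ← Real.rpow_mul (by positivity),
        ← Real.rpow_mul (by positivity), mul_comm]
    rw [← Real.rpow_two, ← hrq, Real.rpow_add_of_nonneg hg2 hrnn hqpos.le, e4]
    ring
  rw [e1, e2, podWeight_eq, pow_mul_gevreyTerm_rpow hb hκ₂nn hann hqpos, ← mul_assoc]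
  have h1 : gevreyTerm β b (a ^ (1 / q) * κ₂) u ^ q ≤ T :=
    (Finset.single_le_sum (fun v _ => Real.rpow_nonneg (gevreyTerm_nonneg hb
      (by positivity : 0 ≤ a ^ (1 / q) * κ₂) v) q) (Finset.mem_univ u)).trans (hT s)
  have h2 : 0 ≤ gevreyTerm β b κ₁ u ^ r := Real.rpow_nonneg hg1 _
  gcongr

/-- The weight sums in the component-by-component bound are bounded independently of the
dimension. -/
lemma exists_sum_podWeight_rpow_le {C β μmin p lam : ℝ} (hC : 0 < C) (hμ : 0 < μmin)
    (hlam : 1 / 2 < lam) (hp : 0 < p) (hβp : β * p < 1) {b : ℕ → ℝ} (hb : ∀ j, 0 ≤ b j)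
    (hsum : Summable fun j => b j ^ p) (hpq : p ≤ 2 * lam / (1 + lam)) :
    ∃ T : ℝ, 0 ≤ T ∧ ∀ s : ℕ, ∑ u ∈ (Finset.univ : Finset (Finset (Fin s))).erase ∅,
      podWeight C β μmin lam b u ^ lam * bernPowSum lam ^ u.card ≤ T := by
  set κ₁ := podConst C β μmin lam with hκ₁
  have hκ₁pos : 0 < κ₁ := podConst_pos hC hμ hlam
  set q := 2 * lam / (1 + lam) with hq
  have hqpos : 0 < q := hp.trans_le hpq
  have hρ := bernPowSum_nonneg lam
  have hκnn : 0 ≤ bernPowSum lam ^ (1 / q) * κ₁ := by positivity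
  obtain ⟨T, hTnn, hT⟩ := exists_sum_gevreyTerm_rpow_le_of_le
    (κ := bernPowSum lam ^ (1 / q) * κ₁) hp hβp hb hsum hκnn hpq
  refine ⟨T, hTnn, fun s => le_trans ?_ (hT s)⟩
  refine le_trans (Finset.sum_le_sum_of_subset_of_nonneg (Finset.erase_subset _ _)
    fun u _ _ => mul_nonneg (Real.rpow_nonneg ?_ _) (pow_nonneg hρ _)) (le_of_eq ?_)
  · rw [podWeight_eq]
    exact Real.rpow_nonneg (gevreyTerm_nonneg hb hκ₁pos.le u) _
  · refine Finset.sum_congr rfl fun u _ => ?_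
    rw [podWeight_eq, ← Real.rpow_mul (gevreyTerm_nonneg hb hκ₁pos.le u), mul_comm,
      ← pow_mul_gevreyTerm_rpow hb hκ₁pos.le hρ hqpos, hq]
    congr 2
    ring

end Assembly

end LatticeBOED

/-! ### The main theorem -/

open LatticeBOED in
theorem mainTheorem7 {Ξ : Type*} (k : ℕ)
    (Γ : Matrix (Fin k) (Fin k) ℝ) (hΓ : Γ.PosDef)
    (μmin : ℝ) (hμ_pos : 0 < μmin) (hμ_le : μmin ≤ 1)
    (hμ : ∀ i, μmin ≤ hΓ.isHermitian.eigenvalues i)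
    (C β p δ : ℝ) (hC : 1 ≤ C) (hβ : 1 ≤ β)
    (hp_pos : 0 < p) (hp_one : p < 1) (hpβ : p < 1 / β)
    (hδ_pos : 0 < δ) (hδ_half : δ < 1 / 2)
    (b : ℕ → ℝ) (hb_nonneg : ∀ j, 0 ≤ b j) (hb : Memℓp b (ENNReal.ofReal p))
    (G : (s : ℕ) → (Fin s → ℝ) → Ξ → EuclideanSpace ℝ (Fin k))
    (hG : LatticeBOED.ParametricRegularity C β b G)
    (K : ℝ) (hK : 0 < K) :
    ∃ C' : ℝ, 0 < C' ∧ ∀ s m : ℕ,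
      (∃ z : Fin s → ℕ, LatticeBOED.IsCBCOutput (2 ^ m)
        (LatticeBOED.podWeight C β μmin (LatticeBOED.weightExponent p δ) b) z) ∧
      ∀ z : Fin s → ℕ, LatticeBOED.IsCBCOutput (2 ^ m)
        (LatticeBOED.podWeight C β μmin (LatticeBOED.weightExponent p δ) b) z →
      ∀ (ξ : Ξ) (y : EuclideanSpace ℝ (Fin k)), (∀ i, y i ∈ Set.Icc (-K) K) →
      IntegrableOn (fun θ => LatticeBOED.likelihood Γ y (G s θ ξ)) (LatticeBOED.paramBox s) ∧
      ∀ R : ℕ, 0 < R →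
        MemLp (LatticeBOED.cubatureError (2 ^ m) z R
          (fun θ => LatticeBOED.likelihood Γ y (G s θ ξ))) 2 (LatticeBOED.shiftLaw s R) ∧
        LatticeBOED.rmsError (2 ^ m) z R (fun θ => LatticeBOED.likelihood Γ y (G s θ ξ)) ≤
          C' * ((2 : ℝ) ^ m) ^ (max (-1 / p + 1 / 2) (-1 + δ)) := by
  have hlam := weightExponent_gt hδ_pos hδ_half hp_one
  have hlam1 := (weightExponent_lt hδ_half hp_one).le
  have hpq := le_two_mul_weightExponent_div hδ_pos hδ_half hp_one
  have hexp := neg_inv_weightExponent_le hp_pos hδ_half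
  set lam := weightExponent p δ with hlam_def
  have h0 : 0 < lam := by linarith
  have hCpos : 0 < C := by linarith
  have hβp : β * p < 1 := by
    rw [lt_div_iff₀ (by linarith)] at hpβ
    linarith
  have hsum : Summable fun j => b j ^ p := by
    have hpt : (ENNReal.ofReal p).toReal = p := ENNReal.toReal_ofReal hp_pos.le
    have h := (memℓp_gen_iff (by rw [hpt]; exact hp_pos)).1 hb
    simpa [hpt, Real.norm_of_nonneg (hb_nonneg _)] using h
  obtain ⟨A, κ, -, hκ, hreg⟩ := exists_likelihood_gevreyBound hΓ hCpos.le hβ hK.le hb_nonneg hG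
  obtain ⟨S₀, hS₀, hdom⟩ := exists_gevreyTerm_sq_le_podWeight hCpos hμ_pos hlam hp_pos hβp
    hb_nonneg hsum hpq A hκ
  obtain ⟨T, hT, hsumT⟩ := exists_sum_podWeight_rpow_le hCpos hμ_pos hlam hp_pos hβp
    hb_nonneg hsum hpq
  -- The factor `2` comes from `φ(2^m) ≥ 2^m / 2`; the summand `1` secures positivity when `S₀` or
  -- `T` is zero.
  refine ⟨Real.sqrt S₀ * (2 * T) ^ (1 / (2 * lam)) + 1, by positivity, fun s m => ?_⟩
  have hn : 0 < 2 ^ m := by positivity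
  refine ⟨exists_isCBCOutput hn _, fun z hz ξ y hy => ?_⟩
  obtain ⟨hcont, E, hE, hE0, hEb⟩ := hreg s ξ y hy
  refine ⟨hcont.integrableOn_compact isCompact_Icc, fun R hR => ?_⟩
  have hγ : ∀ u : Finset (Fin s), 0 ≤ podWeight C β μmin lam b u := by
    intro u
    rw [podWeight_eq]
    exact Real.rpow_nonneg (gevreyTerm_nonneg hb_nonneg (podConst_pos hCpos hμ_pos hlam).le u) _
  obtain ⟨hL2, hrms⟩ := rmsError_le_of_weights hn z hR hcont hE hE0
    (M := fun u => A * gevreyTerm β b κ u) hEb hγ hS₀ (hdom s)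
  refine ⟨hL2, hrms.trans ?_⟩
  set e := ∑ u ∈ (Finset.univ : Finset (Finset (Fin s))).erase ∅,
    podWeight C β μmin lam b u * latticeBernAvg (2 ^ m) u z with he
  have henn : 0 ≤ e := Finset.sum_nonneg fun u _ =>
    mul_nonneg (hγ u) (latticeBernAvg_nonneg hn u z)
  have hN : (0 : ℝ) < 2 ^ m := by positivity
  have hcbc : e ^ lam ≤ 2 * T / 2 ^ m := by
    have h1 := (hz.card_mul_rpow_le hn hγ hlam hlam1).trans (hsumT s)
    have h2 : (2 : ℝ) ^ m ≤ 2 * ((cbcCandidates (2 ^ m)).card : ℝ) := by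
      exact_mod_cast two_pow_le_two_mul_card_cbcCandidates m
    have h3 : 0 ≤ e ^ lam := Real.rpow_nonneg henn _
    rw [le_div_iff₀ hN]
    nlinarith
  have hsqrt : Real.sqrt e ≤ (2 * T) ^ (1 / (2 * lam)) * ((2 : ℝ) ^ m) ^ (-(1 / (2 * lam))) := by
    have h1 := Real.rpow_le_rpow (Real.rpow_nonneg henn _) hcbc
      (by positivity : 0 ≤ 1 / (2 * lam))
    rw [← Real.rpow_mul henn, Real.div_rpow (by positivity) hN.le] at h1
    have h2 : lam * (1 / (2 * lam)) = 1 / 2 := by field_simp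
    rwa [h2, ← Real.sqrt_eq_rpow, div_eq_mul_inv, ← Real.rpow_neg hN.le] at h1
  have hone : (1 : ℝ) ≤ 2 ^ m := one_le_pow₀ (by norm_num)
  rw [Real.sqrt_mul hS₀]
  calc Real.sqrt S₀ * Real.sqrt e
      ≤ Real.sqrt S₀ * ((2 * T) ^ (1 / (2 * lam)) * ((2 : ℝ) ^ m) ^ (-(1 / (2 * lam)))) := by
        gcongr
    _ ≤ Real.sqrt S₀ * ((2 * T) ^ (1 / (2 * lam)) *
          ((2 : ℝ) ^ m) ^ (max (-1 / p + 1 / 2) (-1 + δ))) := by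
        gcongr
    _ = Real.sqrt S₀ * (2 * T) ^ (1 / (2 * lam)) *
          ((2 : ℝ) ^ m) ^ (max (-1 / p + 1 / 2) (-1 + δ)) := by ring
    _ ≤ _ := by
        gcongr
        linarith
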